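/- Let $I=[-1,1]$ and let $m,n$ be finite positive Borel measures on $I$ that have no atoms at the endpoints $\pm1$ and have the same (closed) support. Let $\mathcal H=L^2(I;\mathbf C^2)$ and $\mathcal H^{(2)}=L^2(I\times I;M_2(\mathbf C))$, and put $\langle f,g\rangle=\int_{-1}^1\bigl(f_1\overline{g_2}+f_2\overline{g_1}\bigr)\,dx$. Let $$D_0^{-1}g(x)=\tfrac12\int_{-1}^x g\,dy-\tfrac12\int_x^1 g\,dy\quad\text{if }\int_{-1}^1 g=0,\qquad D_0^{-1}g=0\quad\text{if $g$ is constant},$$ extended linearly to $\mathcal H$; for a continuous $\varphi=(\varphi_1,\varphi_2)$ let $M\varphi$ be the pair of complex measures $(\varphi_2\,dn,\ \varphi_1\,dm)$; and for a complex measure $\mu$ let $D_1^{-1}\mu(x)=\tfrac12\int_{[-1,x)}(y+1)\,d\mu(y)+\tfrac12\int_{[x,1]}(y-1)\,d\mu(y)$. Let $T=D_1^{-1}MD_0^{-1}:\mathcal H\to\mathcal H$. An eigenvalue is a $\lambda\in\mathbf C$ for which there is a nonzero $f\in\mathcal H$ (an eigenfunction) with $f=\lambda Tf$. Let $\{\lambda_\nu\}$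 be the set of eigenvalues, and for each $\nu$ let $f_\nu$ be any eigenfunction with eigenvalue $\lambda_\nu$. Then $T$ is compact and $\langle f_\nu,f_\nu\rangle\neq0$ for every $\nu$. Let $$E_\nu(x,y)=\frac1{\langle f_\nu,f_\nu\rangle}\begin{bmatrix} f_{\nu,1}(x)\overline{f_{\nu,2}(y)}& f_{\nu,1}(x)\overline{f_{\nu,1}(y)}\\ f_{\nu,2}(x)\overline{f_{\nu,2}(y)}&f_{\nu,2}(x)\overline{f_{\nu,1}(y)}\end{bmatrix}$$ (the conjugations may be dropped when $f_\nu$ is real-valued). For every $\lambda\in\mathbf C$ that is not an eigenvalue, $I-\lambda T$ is invertible, and the partial sums of the series $$\sum_\nu\frac{\lambda}{\lambda-\lambda_\nu}E_\nu(x,y)$$ converge weakly in $\mathcal H^{(2)}$, for every ordering of the series (precisely: along the net of finite sets of eigenvalues). The weak limit $\widehat K_\lambda$ is the integral kernel of $R_\lambda=-\lambda T(I-\lambda T)^{-1}$, that is, $R_\lambda g(x)=\int_{-1}^1\widehat K_\lambda(x,y)g(y)\,dy$ for almost every $x$, for all $g\in\mathcal H$. -/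

import Mathlib

open MeasureTheory Set Filter Topology

noncomputable section

namespace Beam

/-- The interval `[-1, 1]`, with Lebesgue measure as its `volume`. -/
abbrev I : Type := Set.Icc (-1 : ℝ) 1

instance : MeasureSpace I := Measure.Subtype.measureSpace

lemma volume_univ_I : (volume : Measure I) univ = 2 := by
  rw [Measure.Subtype.volume_univ nullMeasurableSet_Icc, Real.volume_Icc]
  norm_num

instance : IsFiniteMeasure (volume : Measure I) where
  measure_univ_lt_top := by rw [volume_univ_I]; norm_num

/-- The Hilbert space `L²([-1, 1]; ℂ²)`.  The two components of a vector are indexed by `0`, `1`. -/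
abbrev H : Type := Lp (EuclideanSpace ℂ (Fin 2)) 2 (volume : Measure I)

/-- The Hilbert space `L²([-1, 1] × [-1, 1]; M₂(ℂ))`.  A matrix is stored through its entries
`(i, j)`, and `M₂(ℂ)` carries the Hilbert-Schmidt inner product. -/
abbrev H2 : Type :=
  Lp (EuclideanSpace ℂ (Fin 2 × Fin 2)) 2 ((volume : Measure I).prod (volume : Measure I))

/-- The mean value of a scalar function on `[-1, 1]`. -/
def mean (g : I → ℂ) : ℂ := (1 / 2 : ℂ) * ∫ y, g y

/-- The inverse `D₀⁻¹` of the derivative: it sends `g` of mean zero to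
`½ ∫_{-1}^x g - ½ ∫_x^1 g`, and constants to zero (hence the subtraction of the mean).  It acts on
vector functions componentwise. -/
def D0inv (g : I → ℂ) (x : I) : ℂ :=
  (1 / 2 : ℂ) * (∫ y in Iio x, (g y - mean g)) - (1 / 2 : ℂ) * ∫ y in Ioi x, (g y - mean g)

/-- The inverse `D₁⁻¹` of the derivative, applied to the complex measure `ψ dr`:
`½ ∫_{[-1,x)} (y + 1) ψ(y) dr(y) + ½ ∫_{[x,1]} (y - 1) ψ(y) dr(y)`. -/
def D1inv (r : Measure I) (ψ : I → ℂ) (x : I) : ℂ :=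
  (1 / 2 : ℂ) * (∫ y in Iio x, ((y : ℝ) + 1 : ℂ) * ψ y ∂r) +
    (1 / 2 : ℂ) * ∫ y in Ici x, ((y : ℝ) - 1 : ℂ) * ψ y ∂r

/-- The function `D₁⁻¹ M D₀⁻¹ f`, where `M = [[0, n], [m, 0]]`, i.e. `M φ = (φ₂ n, φ₁ m)`. -/
def TFun (m n : Measure I) (f : I → EuclideanSpace ℂ (Fin 2)) (x : I) :
    EuclideanSpace ℂ (Fin 2) :=
  !₂[D1inv n (D0inv fun y => f y 1) x, D1inv m (D0inv fun y => f y 0) x]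

/-! Facts needed to see `TFun` as a bounded operator. -/

lemma measurable_primitives {r : Measure I} [IsFiniteMeasure r] {h : I → ℂ}
    (hh : AEStronglyMeasurable h r) :
    Measurable (fun x => ∫ y in Iio x, h y ∂r) ∧ Measurable (fun x => ∫ y in Ioi x, h y ∂r) ∧
      Measurable (fun x => ∫ y in Ici x, h y ∂r) := by
  have key : ∀ s : Set (I × I), MeasurableSet s →
      Measurable (fun x => ∫ y in {y | (x, y) ∈ s}, h y ∂r) := by
    intro s hs
    have h1 : ∀ x, ∫ y in {y | (x, y) ∈ s}, h y ∂r
        = ∫ y, s.indicator (fun p : I × I => hh.mk h p.2) (x, y) ∂r := by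
      intro x
      have hm : MeasurableSet {y | (x, y) ∈ s} := measurable_prodMk_left hs
      rw [← integral_indicator hm]
      refine integral_congr_ae ?_
      filter_upwards [hh.ae_eq_mk] with y hy
      by_cases hy' : (x, y) ∈ s <;> simp [indicator, hy', hy]
    simp_rw [h1]
    exact ((StronglyMeasurable.indicator
      (hh.stronglyMeasurable_mk.comp_measurable measurable_snd) hs).integral_prod_right').measurable
  refine ⟨key {p | p.2 < p.1} (measurableSet_lt measurable_snd measurable_fst),
    key {p | p.1 < p.2} (measurableSet_lt measurable_fst measurable_snd),
    key {p | p.1 ≤ p.2} (measurableSet_le measurable_fst measurable_snd)⟩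

lemma integrable_comp (f : H) (i : Fin 2) : Integrable (fun y => f y i) (volume : Measure I) :=
  ((Lp.memLp f).eval_piLp i).integrable (by norm_num)

lemma D0inv_congr {g h : I → ℂ} (e : g =ᵐ[volume] h) : D0inv g = D0inv h := by
  have hm : mean g = mean h := by rw [mean, mean, integral_congr_ae e]
  funext x
  have e' : (fun y => g y - mean g) =ᵐ[volume] fun y => h y - mean h := by
    filter_upwards [e] with y hy
    rw [hy, hm]
  rw [D0inv, D0inv, integral_congr_ae (ae_restrict_of_ae e'),
    integral_congr_ae (ae_restrict_of_ae e')]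

lemma D0inv_add {g h : I → ℂ} (hg : Integrable g volume) (hh : Integrable h volume) (x : I) :
    D0inv (fun y => g y + h y) x = D0inv g x + D0inv h x := by
  have hm : mean (fun y => g y + h y) = mean g + mean h := by
    rw [mean, mean, mean, integral_add hg hh]; ring
  have e : (fun y => g y + h y - mean (fun y => g y + h y)) =
      fun y => (g y - mean g) + (h y - mean h) := by
    funext y; rw [hm]; ring
  have hg' : Integrable (fun y => g y - mean g) volume := hg.sub (integrable_const _)
  have hh' : Integrable (fun y => h y - mean h) volume := hh.sub (integrable_const _)
  rw [D0inv, D0inv, D0inv, e, integral_add hg'.integrableOn hh'.integrableOn,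
    integral_add hg'.integrableOn hh'.integrableOn]
  ring

lemma D0inv_smul (c : ℂ) (g : I → ℂ) (x : I) :
    D0inv (fun y => c * g y) x = c * D0inv g x := by
  have hm : mean (fun y => c * g y) = c * mean g := by
    rw [mean, mean, integral_const_mul]; ring
  have e : (fun y => c * g y - mean (fun y => c * g y)) = fun y => c * (g y - mean g) := by
    funext y; rw [hm]; ring
  rw [D0inv, D0inv, e, integral_const_mul, integral_const_mul]
  ring

lemma measurable_D0inv {g : I → ℂ} (hg : Integrable g volume) : Measurable (D0inv g) := by
  have h := measurable_primitives (hg.sub (integrable_const (mean g))).aestronglyMeasurable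
  exact (h.1.const_mul _).sub (h.2.1.const_mul _)

lemma norm_D0inv_le {g : I → ℂ} (hg : Integrable g volume) (x : I) :
    ‖D0inv g x‖ ≤ ∫ y, ‖g y - mean g‖ := by
  have hg' := (hg.sub (integrable_const (mean g)))
  have b : ∀ s : Set I, ‖∫ y in s, (g y - mean g)‖ ≤ ∫ y, ‖g y - mean g‖ := fun s =>
    (norm_integral_le_integral_norm _).trans
      (setIntegral_le_integral hg'.norm (Eventually.of_forall fun y => norm_nonneg _))
  rw [D0inv]
  refine (norm_sub_le _ _).trans ?_
  rw [norm_mul, norm_mul]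
  have := b (Iio x)
  have := b (Ioi x)
  norm_num
  linarith

lemma norm_D0inv_le' (f : H) (i : Fin 2) (x : I) : ‖D0inv (fun y => f y i) x‖ ≤ 4 * ‖f‖ := by
  have hf := integrable_comp f i
  have hvol : (volume : Measure I).real univ = 2 := by
    rw [Measure.real, volume_univ_I]
    norm_num
  have h1 : ∫ y, ‖f y i‖ ≤ 2 * ‖f‖ := by
    have hn : eLpNorm (fun y => f y i) 1 volume ≤ eLpNorm f 2 volume * 2 := by
      calc eLpNorm (fun y => f y i) 1 volume ≤ eLpNorm f 1 volume :=
            eLpNorm_mono fun y => PiLp.norm_apply_le (f y) i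
        _ ≤ eLpNorm f 2 volume * volume univ ^ (1 / (1 : ENNReal).toReal - 1 / (2 : ENNReal).toReal) :=
            eLpNorm_le_eLpNorm_mul_rpow_measure_univ (by norm_num) (Lp.memLp f).1
        _ ≤ eLpNorm f 2 volume * 2 := by
            gcongr
            rw [volume_univ_I]
            norm_num
            calc (2 : ENNReal) ^ (1 / 2 : ℝ) ≤ 2 ^ (1 : ℝ) :=
                  ENNReal.rpow_le_rpow_of_exponent_le (by norm_num) (by norm_num)
              _ = 2 := ENNReal.rpow_one _
    rw [integral_norm_eq_lintegral_enorm hf.1, ← eLpNorm_one_eq_lintegral_enorm, Lp.norm_def, mul_comm]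
    have := ENNReal.toReal_mono (ENNReal.mul_ne_top (Lp.eLpNorm_ne_top f) (by norm_num)) hn
    simpa using this
  have hm : ‖mean fun y => f y i‖ ≤ ‖f‖ := by
    rw [mean, norm_mul]
    have := norm_integral_le_integral_norm (μ := (volume : Measure I)) (fun y => f y i)
    norm_num
    linarith
  refine (norm_D0inv_le hf x).trans ?_
  calc ∫ y, ‖f y i - mean fun y => f y i‖ ≤ ∫ y, (‖f y i‖ + ‖mean fun y => f y i‖) :=
        integral_mono (hf.sub (integrable_const _)).norm (hf.norm.add (integrable_const _))
          fun y => norm_sub_le _ _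
    _ = (∫ y, ‖f y i‖) + 2 * ‖mean fun y => f y i‖ := by
        rw [integral_add hf.norm (integrable_const _), integral_const, hvol, smul_eq_mul]
    _ ≤ 4 * ‖f‖ := by linarith

lemma integrable_D0inv (r : Measure I) [IsFiniteMeasure r] (f : H) (i : Fin 2) :
    Integrable (D0inv fun y => f y i) r :=
  Integrable.of_bound (measurable_D0inv (integrable_comp f i)).aestronglyMeasurable (4 * ‖f‖)
    (Eventually.of_forall fun x => norm_D0inv_le' f i x)

lemma norm_add_one_le (y : I) : ‖((y : ℝ) + 1 : ℂ)‖ ≤ 2 ∧ ‖((y : ℝ) - 1 : ℂ)‖ ≤ 2 := by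
  obtain ⟨y, h1, h2⟩ := y
  constructor
  · rw [← Complex.ofReal_one, ← Complex.ofReal_add, Complex.norm_real, Real.norm_eq_abs, abs_le]
    constructor <;> simp <;> linarith
  · rw [← Complex.ofReal_one, ← Complex.ofReal_sub, Complex.norm_real, Real.norm_eq_abs, abs_le]
    constructor <;> simp <;> linarith

lemma integrable_D1_terms {r : Measure I} {ψ : I → ℂ} (hψ : Integrable ψ r) :
    Integrable (fun y : I => ((y : ℝ) + 1 : ℂ) * ψ y) r ∧
      Integrable (fun y : I => ((y : ℝ) - 1 : ℂ) * ψ y) r := by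
  constructor
  · exact hψ.bdd_mul (c := 2) (by fun_prop) (Eventually.of_forall fun y => (norm_add_one_le y).1)
  · exact hψ.bdd_mul (c := 2) (by fun_prop) (Eventually.of_forall fun y => (norm_add_one_le y).2)

lemma D1inv_add {r : Measure I} {ψ χ : I → ℂ} (hψ : Integrable ψ r) (hχ : Integrable χ r) (x : I) :
    D1inv r (fun y => ψ y + χ y) x = D1inv r ψ x + D1inv r χ x := by
  simp only [D1inv, mul_add]
  rw [integral_add (integrable_D1_terms hψ).1.integrableOn (integrable_D1_terms hχ).1.integrableOn,
    integral_add (integrable_D1_terms hψ).2.integrableOn (integrable_D1_terms hχ).2.integrableOn]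
  ring

lemma D1inv_smul {r : Measure I} (c : ℂ) (ψ : I → ℂ) (x : I) :
    D1inv r (fun y => c * ψ y) x = c * D1inv r ψ x := by
  simp only [D1inv, mul_left_comm _ c, integral_const_mul]
  ring

lemma measurable_D1inv {r : Measure I} [IsFiniteMeasure r] {ψ : I → ℂ} (hψ : Integrable ψ r) :
    Measurable (D1inv r ψ) :=
  ((measurable_primitives (integrable_D1_terms hψ).1.1).1.const_mul _).add
    ((measurable_primitives (integrable_D1_terms hψ).2.1).2.2.const_mul _)

lemma norm_D1inv_le {r : Measure I} [IsFiniteMeasure r] {ψ : I → ℂ} {C : ℝ}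
    (hC : ∀ y, ‖ψ y‖ ≤ C) (x : I) : ‖D1inv r ψ x‖ ≤ 2 * r.real univ * C := by
  have C0 : 0 ≤ C := (norm_nonneg _).trans (hC x)
  have b : ∀ (w : I → ℂ), (∀ y, ‖w y‖ ≤ 2) → ∀ s : Set I,
      ‖∫ y in s, w y * ψ y ∂r‖ ≤ 2 * C * r.real univ := by
    intro w hw s
    refine (norm_setIntegral_le_of_norm_le_const (C := 2 * C) (measure_lt_top r s) ?_).trans ?_
    · intro y _
      rw [norm_mul]
      exact mul_le_mul (hw y) (hC y) (norm_nonneg _) (by norm_num)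
    · exact mul_le_mul_of_nonneg_left (measureReal_mono (subset_univ _)) (by positivity)
  have h1 := b _ (fun y => (norm_add_one_le y).1) (Iio x)
  have h2 := b _ (fun y => (norm_add_one_le y).2) (Ici x)
  rw [D1inv]
  refine (norm_add_le _ _).trans ?_
  rw [norm_mul, norm_mul]
  norm_num
  linarith

lemma memLp_TFun (m n : Measure I) [IsFiniteMeasure m] [IsFiniteMeasure n] (f : H) :
    MemLp (TFun m n f) 2 volume := by
  refine MemLp.of_eval_piLp fun i => ?_
  fin_cases i
  · exact MemLp.of_bound (measurable_D1inv (integrable_D0inv n f 1)).aestronglyMeasurable _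
      (Eventually.of_forall fun x => norm_D1inv_le (norm_D0inv_le' f 1) x)
  · exact MemLp.of_bound (measurable_D1inv (integrable_D0inv m f 0)).aestronglyMeasurable _
      (Eventually.of_forall fun x => norm_D1inv_le (norm_D0inv_le' f 0) x)

lemma norm_TFun_le (m n : Measure I) [IsFiniteMeasure m] [IsFiniteMeasure n] (f : H) (x : I) :
    ‖TFun m n f x‖ ≤ 8 * (m.real univ + n.real univ) * ‖f‖ := by
  have h1 := norm_D1inv_le (r := n) (norm_D0inv_le' f 1) x
  have h0 := norm_D1inv_le (r := m) (norm_D0inv_le' f 0) x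
  have : ‖TFun m n f x‖ ≤ ‖D1inv n (D0inv fun y => f y 1) x‖ +
      ‖D1inv m (D0inv fun y => f y 0) x‖ := by
    rw [TFun, EuclideanSpace.norm_eq, Fin.sum_univ_two]
    refine Real.sqrt_le_iff.2 ⟨by positivity, ?_⟩
    simp only [Matrix.cons_val_zero, Matrix.cons_val_one]
    nlinarith [norm_nonneg (D1inv n (D0inv fun y => f y 1) x),
      norm_nonneg (D1inv m (D0inv fun y => f y 0) x)]
  nlinarith

/-- The operator `T = D₁⁻¹ M D₀⁻¹` on `L²([-1, 1]; ℂ²)`; it is given by `TFun`. -/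
def T (m n : Measure I) [IsFiniteMeasure m] [IsFiniteMeasure n] : H →L[ℂ] H :=
  LinearMap.mkContinuous
    { toFun := fun f => (memLp_TFun m n f).toLp
      map_add' := by
        intro f g
        rw [← MemLp.toLp_add]
        refine MemLp.toLp_congr _ _ (Eventually.of_forall fun x => ?_)
        have hi : ∀ i : Fin 2, (D0inv fun y => (f + g : H) y i) =
            fun x => D0inv (fun y => f y i) x + D0inv (fun y => g y i) x := by
          intro i
          rw [D0inv_congr (h := fun y => f y i + g y i) ?_]
          · exact funext (D0inv_add (integrable_comp f i) (integrable_comp g i))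
          · filter_upwards [Lp.coeFn_add f g] with y hy
            rw [hy]; rfl
        ext i
        fin_cases i
        · exact (congrArg (fun φ => D1inv n φ x) (hi 1)).trans
            (D1inv_add (integrable_D0inv n f 1) (integrable_D0inv n g 1) x)
        · exact (congrArg (fun φ => D1inv m φ x) (hi 0)).trans
            (D1inv_add (integrable_D0inv m f 0) (integrable_D0inv m g 0) x)
      map_smul' := by
        intro c f
        rw [RingHom.id_apply, ← MemLp.toLp_const_smul]
        refine MemLp.toLp_congr _ _ (Eventually.of_forall fun x => ?_)
        have hi : ∀ i : Fin 2, (D0inv fun y => (c • f : H) y i) =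
            fun x => c * D0inv (fun y => f y i) x := by
          intro i
          rw [D0inv_congr (h := fun y => c * f y i) ?_]
          · exact funext (D0inv_smul c _)
          · filter_upwards [Lp.coeFn_smul c f] with y hy
            rw [hy]; rfl
        ext i
        fin_cases i
        · exact (congrArg (fun φ => D1inv n φ x) (hi 1)).trans (D1inv_smul c _ x)
        · exact (congrArg (fun φ => D1inv m φ x) (hi 0)).trans (D1inv_smul c _ x) }
    ((measureUnivNNReal (volume : Measure I) : ℝ) ^ (ENNReal.toReal 2)⁻¹ * (8 * (m.real univ + n.real univ)))
    (by
      intro f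
      have h := Lp.norm_le_of_ae_bound (f := (memLp_TFun m n f).toLp)
        (C := 8 * (m.real univ + n.real univ) * ‖f‖) (by positivity)
        (by
          filter_upwards [(memLp_TFun m n f).coeFn_toLp] with x hx
          rw [hx]
          exact norm_TFun_le m n f x)
      refine h.trans (le_of_eq ?_)
      ring)

lemma coeFn_T (m n : Measure I) [IsFiniteMeasure m] [IsFiniteMeasure n] (f : H) :
    T m n f =ᵐ[volume] TFun m n f :=
  (memLp_TFun m n f).coeFn_toLp

/-- The eigenvalues of the problem `f = lam T f`, `f ≠ 0`. -/
def eigenvalues (m n : Measure I) [IsFiniteMeasure m] [IsFiniteMeasure n] : Set ℂ :=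
  {lam | ∃ f : H, f ≠ 0 ∧ f = lam • T m n f}

/-- The indefinite form `⟨f, g⟩ = ∫ (f₁ conj g₂ + f₂ conj g₁)`. -/
def indef (f g : H) : ℂ :=
  ∫ x, (f x 0 * (starRingEnd ℂ) (g x 1) + f x 1 * (starRingEnd ℂ) (g x 0))

/-- The matrix kernel of the projection `h ↦ (⟨h, f⟩ / ⟨f, f⟩) f`: its `(i, j)` entry is
`f_i(x) conj (f_{1-j}(y)) / ⟨f, f⟩`.  For a real-valued `f` the conjugation does nothing. -/
def EFun (f : H) (p : I × I) : EuclideanSpace ℂ (Fin 2 × Fin 2) :=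
  WithLp.toLp 2 fun ij => f p.1 ij.1 * (starRingEnd ℂ) (f p.2 (1 - ij.2)) / indef f f

lemma memLp_EFun (f : H) :
    MemLp (EFun f) 2 ((volume : Measure I).prod (volume : Measure I)) := by
  refine MemLp.of_eval_piLp fun ij => ?_
  have h1 := (Lp.memLp f).eval_piLp ij.1
  have h2 := (Lp.memLp f).eval_piLp (1 - ij.2)
  have hm : AEStronglyMeasurable (fun p : I × I => f p.1 ij.1 * (starRingEnd ℂ) (f p.2 (1 - ij.2)))
      ((volume : Measure I).prod (volume : Measure I)) :=
    (h1.1.comp_fst).mul (RCLike.continuous_conj.comp_aestronglyMeasurable h2.1.comp_snd)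
  have h3 : MemLp (fun p : I × I => f p.1 ij.1 * (starRingEnd ℂ) (f p.2 (1 - ij.2))) 2
      ((volume : Measure I).prod (volume : Measure I)) := by
    rw [memLp_two_iff_integrable_sq_norm hm]
    have := ((memLp_two_iff_integrable_sq_norm h1.1).1 h1).mul_prod
      ((memLp_two_iff_integrable_sq_norm h2.1).1 h2)
    simpa [mul_pow] using this
  have := h3.mul_const (indef f f)⁻¹
  simpa [EFun, div_eq_mul_inv] using this

/-- The kernel of the projection along an eigenfunction, as an element of `L²(I × I; M₂(ℂ))`. -/
def E (f : H) : H2 := (memLp_EFun f).toLp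

/-- The operator `R_lam = - lam T (1 - lam T)⁻¹`.  (`Ring.inverse` is the inverse in the algebra of
bounded operators; it is meaningful when `1 - lam T` is invertible.) -/
def R (m n : Measure I) [IsFiniteMeasure m] [IsFiniteMeasure n] (lam : ℂ) : H →L[ℂ] H :=
  -(lam • (T m n * Ring.inverse (1 - lam • T m n)))

/-- `K` is the integral kernel of `A`: `(A g)(x) = ∫ K(x, y) g(y) dy` for almost every `x`. -/
def IsKernelOf (K : H2) (A : H →L[ℂ] H) : Prop :=
  ∀ g : H, ∀ i : Fin 2, ∀ᵐ x : I, A g x i = ∫ y : I, ∑ j : Fin 2, K (x, y) (i, j) * g y j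

end Beam

end

/-! Let `J` swap the two components and let `A f = (D₀⁻¹ f₁, D₀⁻¹ f₂)`, with values in `W = L²(m) ⊕
L²(n)`. Since `D₁⁻¹` is minus the adjoint of `D₀⁻¹`, the operator factors as `T = -J A* A`
(`factorization`), and the indefinite form is `⟨f, g⟩ = (f, J g)`. `T` itself is not self-adjoint,
but `S = -A J A*` on `W` is, and `A T = S A`. So `A` carries solutions of `f = ν T f` to
eigenvectors of `S` with eigenvalue `1/ν`. Hence `ν` is real, the `A f_ν` are orthogonal, and `⟨f_ν,
f_ν⟩ = -ν ‖A f_ν‖²` is nonzero.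

The spectral theorem for the compact operator `S` expands every `A x` in the vectors `A f_ν`
(`hasSum_eigen`). Two facts are needed. The kernel of `S` must be orthogonal to the range of `A`;
this holds because `J` preserves `ker A`, which is where equality of the supports enters. And one
`f_ν` must span each eigenspace (`eigenspace_simple`). The latter is a positivity argument: the
primitives `φ = D₀⁻¹ f₁`, `ψ = D₀⁻¹ f₂` solve a coupled Volterra system with nonnegative kernel and
vanish at the right endpoint. With matched initial slopes they could only grow, so they must be
zero.

Applying `lam J A*` to the expansion of `A u`, where `u = (1 - lam T)⁻¹ g`, gives the expansion of
`R_lam g` (`hasSum_resolvent`). `A` is Hilbert–Schmidt, so the `L²` norms of the kernel terms are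
summable (`summable_kernel_norms`). The series thus converges absolutely in norm, and weak
convergence along finite sets follows. -/

noncomputable section

namespace Beam

open ContinuousLinearMap
open scoped InnerProductSpace ComplexConjugate

/-! ### Hilbert–Schmidt operators. -/

section Abstract

variable {H W : Type*} [NormedAddCommGroup H] [InnerProductSpace ℂ H] [CompleteSpace H]
  [NormedAddCommGroup W] [InnerProductSpace ℂ W] [CompleteSpace W]

omit [CompleteSpace H] in
/-- The rank one pieces of an operator along a Hilbert basis with square-summable images sum to the
operator in norm. -/
lemma hasSum_rankOne_of_sum_norm_sq_le {ι : Type*} (b : HilbertBasis ι ℂ H) (A : H →L[ℂ] W) {C : ℝ}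
    (hC : ∀ F : Finset ι, ∑ i ∈ F, ‖A (b i)‖ ^ 2 ≤ C) :
    HasSum (fun i => InnerProductSpace.rankOne ℂ (A (b i)) (b i)) A := by
  have hs : Summable fun i => ‖A (b i)‖ ^ 2 :=
    summable_of_sum_le (fun i => by positivity) hC
  have key : Summable fun i => InnerProductSpace.rankOne ℂ (A (b i)) (b i) := by
    rw [summable_iff_vanishing_norm]
    intro ε hε
    obtain ⟨F, hF⟩ := summable_iff_vanishing_norm.1 hs ((ε / 2) ^ 2) (by positivity)
    refine ⟨F, fun G hG => lt_of_le_of_lt ?_ (half_lt_self hε)⟩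
    refine ContinuousLinearMap.opNorm_le_bound _ (by positivity) fun x => ?_
    have h1 := hF G hG
    rw [Real.norm_of_nonneg (Finset.sum_nonneg fun i _ => by positivity)] at h1
    -- Bessel for `x` and Cauchy–Schwarz bound the norm of a finite block of rank one terms by the
    -- square root of its sum of `‖A (b i)‖ ^ 2`.
    have h2 := b.orthonormal.sum_inner_products_le x (s := G)
    have h3 := Finset.sum_mul_sq_le_sq_mul_sq G (fun i => ‖⟪b i, x⟫_ℂ‖) (fun i => ‖A (b i)‖)
    have h4 : ‖(∑ i ∈ G, InnerProductSpace.rankOne ℂ (A (b i)) (b i)) x‖ ≤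
        ∑ i ∈ G, ‖⟪b i, x⟫_ℂ‖ * ‖A (b i)‖ := by
      rw [_root_.sum_apply]
      refine norm_sum_le_of_le _ fun i _ => ?_
      simp [norm_smul]
    refine h4.trans (abs_le_of_sq_le_sq' ?_ (by positivity)).2
    refine h3.trans ?_
    calc _ ≤ ‖x‖ ^ 2 * (ε / 2) ^ 2 := mul_le_mul h2 h1.le (by positivity) (by positivity)
      _ = _ := by ring
  convert key.hasSum
  ext x
  have h1 := (key.hasSum.mapL (ContinuousLinearMap.apply ℂ W x))
  have h2 := (b.hasSum_repr x).mapL A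
  refine h2.unique ?_
  convert h1 using 1
  · funext i
    simp [b.repr_apply_apply]
  · rfl

-- `A` is a norm limit of finite rank operators.
omit [CompleteSpace H] in
lemma isCompactOperator_of_sum_norm_sq_le {ι : Type*} (b : HilbertBasis ι ℂ H) (A : H →L[ℂ] W)
    {C : ℝ} (hC : ∀ F : Finset ι, ∑ i ∈ F, ‖A (b i)‖ ^ 2 ≤ C) : IsCompactOperator A := by
  refine isCompactOperator_of_tendsto (hasSum_rankOne_of_sum_norm_sq_le b A hC)
    (Eventually.of_forall fun F => ?_)
  have : ∀ i, InnerProductSpace.rankOne ℂ (A (b i)) (b i) ∈ compactOperator (RingHom.id ℂ) H W := by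
    intro i
    change IsCompactOperator _
    have h : IsCompactOperator ((ContinuousLinearMap.toSpanSingleton ℂ (A (b i)))) :=
      isCompactOperator_of_locallyCompactSpace_rng _
    exact h.comp_clm (innerSL ℂ (b i))
  exact Submodule.sum_mem (compactOperator (RingHom.id ℂ) H W) fun i _ => this i

/-- By Parseval `‖A* e_k‖²` is the sum over `i` of `|⟨e_k, A b_i⟩|²`. Exchanging the sums and using
Bessel for `e` in `W` gives the same bound as for `A`. -/
lemma sum_norm_sq_adjoint_le {ι κ : Type*} (b : HilbertBasis ι ℂ H) (A : H →L[ℂ] W)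
    {C : ℝ} (hC : ∀ F : Finset ι, ∑ i ∈ F, ‖A (b i)‖ ^ 2 ≤ C) {e : κ → W} (he : Orthonormal ℂ e)
    (G : Finset κ) : ∑ k ∈ G, ‖adjoint A (e k)‖ ^ 2 ≤ C := by
  have h1 : ∀ k, HasSum (fun i => ‖⟪e k, A (b i)⟫_ℂ‖ ^ 2) (‖adjoint A (e k)‖ ^ 2) := by
    intro k
    have h := b.hasSum_inner_mul_inner (adjoint A (e k)) (adjoint A (e k))
    rw [inner_self_eq_norm_sq_to_K] at h
    have h' := Complex.hasSum_re h
    convert h' using 1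
    · funext i
      rw [← inner_conj_symm (b i), adjoint_inner_left, Complex.mul_conj, Complex.normSq_eq_norm_sq]
      norm_cast
    · norm_cast
  refine hasSum_le_of_sum_le (hasSum_sum fun k (_ : k ∈ G) => h1 k) fun F => ?_
  refine (Finset.sum_le_sum fun i _ => ?_).trans (hC F)
  exact he.sum_inner_products_le (A (b i))

/-! ### The factorization `T = -J A* A` and its eigenvectors. -/

/-- The characteristic values of `T`: the `lam` for which `f = lam T f` has a nonzero solution. -/
def charValues (T : H →L[ℂ] H) : Set ℂ := {lam | ∃ f : H, f ≠ 0 ∧ f = lam • T f}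

/-- The Fredholm alternative for `lam⁻¹ - T` when `lam ≠ 0`. -/
lemma isUnit_one_sub_smul {T : H →L[ℂ] H} (hT : IsCompactOperator T) {lam : ℂ}
    (h : lam ∉ charValues T) : IsUnit (1 - lam • T) := by
  by_cases h0 : lam = 0
  · simp [h0]
  rcases hT.hasEigenvalue_or_mem_resolventSet (inv_ne_zero h0) with h1 | h1
  · obtain ⟨v, hv⟩ := h1.exists_hasEigenvector
    refine absurd ⟨v, hv.2, ?_⟩ h
    have : T v = lam⁻¹ • v := hv.apply_eq_smul
    rw [this, smul_inv_smul₀ h0]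
  · rw [spectrum.mem_resolventSet_iff] at h1
    have h2 : (1 - lam • T) = algebraMap ℂ (H →L[ℂ] H) lam *
        (algebraMap ℂ (H →L[ℂ] H) lam⁻¹ - T) := by
      rw [mul_sub, ← map_mul, mul_inv_cancel₀ h0, map_one, ← Algebra.smul_def]
    rw [h2]
    exact ((IsUnit.mk0 lam h0).map _).mul h1

/-- `T = -J A* A` with a self-adjoint involution `J` preserving the kernel of `A`. -/
structure Factorization (T J : H →L[ℂ] H) (A : H →L[ℂ] W) : Prop where
  T_apply : ∀ f, T f = -J (adjoint A (A f))
  invol : ∀ f, J (J f) = f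
  symm : ∀ f g, ⟪J f, g⟫_ℂ = ⟪f, J g⟫_ℂ
  ker : ∀ f, A f = 0 → A (J f) = 0

namespace Factorization

variable {T J : H →L[ℂ] H} {A : H →L[ℂ] W} (hF : Factorization T J A)
include hF

lemma J_inj {f : H} (h : J f = 0) : f = 0 := by
  rw [← hF.invol f, h, map_zero]

section Eigen

variable {lam : ℂ} {f : H} (h0 : f ≠ 0) (h : f = lam • T f)
include h

lemma J_eigen : J f = -(lam • adjoint A (A f)) := by
  conv_lhs => rw [h, hF.T_apply]
  rw [map_smul, map_neg, hF.invol, smul_neg]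

include h0

omit hF [CompleteSpace H] in
lemma char_ne_zero : lam ≠ 0 := by
  rintro rfl
  exact h0 (by rw [h, zero_smul])

lemma A_eigen_ne_zero : A f ≠ 0 := by
  intro hA
  refine h0 (hF.J_inj ?_)
  rw [hF.J_eigen h, hA, map_zero, smul_zero, neg_zero]

/-- Because `A T = (-A J A*) A`, the map `A` transports the eigenvalue problem to a self-adjoint
operator on `W`. -/
lemma AJA_eigen : -(A (J (adjoint A (A f)))) = lam⁻¹ • A f := by
  have := char_ne_zero h0 h
  rw [eq_inv_smul_iff₀ this, smul_neg, ← map_smul, ← map_smul,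
    ← neg_neg (lam • adjoint A (A f)), ← hF.J_eigen h, map_neg, map_neg, neg_neg, hF.invol]

end Eigen

lemma isSymmetric_AJA : (-(A ∘L J ∘L adjoint A)).IsSymmetric := by
  intro x y
  simp only [coe_coe, neg_apply, comp_apply, inner_neg_left, inner_neg_right]
  rw [← adjoint_inner_right, hF.symm, adjoint_inner_left]

lemma conj_char {lam : ℂ} {f : H} (h0 : f ≠ 0) (h : f = lam • T f) :
    (starRingEnd ℂ) lam = lam := by
  have h1 : Module.End.HasEigenvalue ((-(A ∘L J ∘L adjoint A) : W →L[ℂ] W) : W →ₗ[ℂ] W) lam⁻¹ := by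
    refine Module.End.hasEigenvalue_of_hasEigenvector (x := A f)
      ⟨Module.End.mem_eigenspace_iff.2 ?_, hF.A_eigen_ne_zero h0 h⟩
    exact hF.AJA_eigen h0 h
  have := LinearMap.IsSymmetric.conj_eigenvalue_eq_self hF.isSymmetric_AJA h1
  rwa [map_inv₀, inv_inj] at this

/-- The left side is the indefinite square of `f`; the formula shows that it cannot vanish on an
eigenfunction. -/
lemma inner_J_eigen {lam : ℂ} {f : H} (h0 : f ≠ 0) (h : f = lam • T f) :
    ⟪J f, f⟫_ℂ = -(lam * (‖A f‖ : ℂ) ^ 2) := by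
  rw [hF.J_eigen h, inner_neg_left, inner_smul_left, adjoint_inner_left, hF.conj_char h0 h,
    inner_self_eq_norm_sq_to_K]
  rfl

lemma inner_J_eigen_ne_zero {lam : ℂ} {f : H} (h0 : f ≠ 0) (h : f = lam • T f) :
    ⟪J f, f⟫_ℂ ≠ 0 := by
  have h1 := hF.A_eigen_ne_zero h0 h
  rw [hF.inner_J_eigen h0 h]
  simp [char_ne_zero h0 h, h1]

lemma norm_eigen (hJ : ∀ f, ‖J f‖ = ‖f‖) {lam : ℂ} {f : H} (h : f = lam • T f) :
    ‖f‖ = ‖lam‖ * ‖adjoint A (A f)‖ := by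
  rw [← hJ, hF.J_eigen h, norm_neg, norm_smul]

/-- If `J A* v` lies in `ker A`, so does `A* v`, because `J` preserves that kernel; then `‖A* v‖² =
⟨v, A A* v⟩ = 0`. Null vectors of `-A J A*` are therefore orthogonal to the range of `A`. -/
lemma eigenspace_zero {v : W} (hv : A (J (adjoint A v)) = 0) : adjoint A v = 0 := by
  have h := hF.ker _ hv
  rw [hF.invol] at h
  rw [← norm_eq_zero, ← sq_eq_zero_iff, ← Complex.ofReal_eq_zero]
  have := inner_self_eq_norm_sq_to_K (𝕜 := ℂ) (adjoint A v)
  rw [adjoint_inner_left, h, inner_zero_right] at this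
  push_cast
  exact this.symm

variable (f : charValues T → H) (hf0 : ∀ ν, f ν ≠ 0) (hf : ∀ ν, f ν = (ν : ℂ) • T (f ν))
include hf0 hf

lemma orthonormal_eigen :
    Orthonormal ℂ fun ν => ((‖A (f ν)‖⁻¹ : ℝ) : ℂ) • A (f ν) := by
  constructor
  · intro ν
    have := hF.A_eigen_ne_zero (hf0 ν) (hf ν)
    rw [norm_smul, Complex.norm_real, norm_inv, norm_norm, inv_mul_cancel₀ (norm_ne_zero_iff.2 this)]
  · intro ν μ hνμ
    have hne : (ν : ℂ)⁻¹ ≠ (μ : ℂ)⁻¹ := fun h => hνμ (Subtype.ext (inv_injective h))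
    have hmem : ∀ ν : charValues T, A (f ν) ∈ Module.End.eigenspace
        ((-(A ∘L J ∘L adjoint A) : W →L[ℂ] W) : W →ₗ[ℂ] W) (ν : ℂ)⁻¹ := fun ν =>
      Module.End.mem_eigenspace_iff.2 (hF.AJA_eigen (hf0 ν) (hf ν))
    have := (LinearMap.IsSymmetric.orthogonalFamily_eigenspaces hF.isSymmetric_AJA) hne
      ⟨_, hmem ν⟩ ⟨_, hmem μ⟩
    simp only [inner_smul_left, inner_smul_right]
    have h' : ⟪A (f ν), A (f μ)⟫_ℂ = 0 := this
    rw [h', mul_zero, mul_zero]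

/-- The vectors `A f_ν` span the range of `A` when all eigenvalues are simple. -/
lemma hasSum_eigen (hA : IsCompactOperator A)
    (hsimple : ∀ (ν : charValues T) (g : H), g = (ν : ℂ) • T g → ∃ c : ℂ, g = c • f ν) (x : H) :
    HasSum (fun ν => (⟪A (f ν), A x⟫_ℂ / (‖A (f ν)‖ : ℂ) ^ 2) • A (f ν)) (A x) := by
  set e : charValues T → W := fun ν => ((‖A (f ν)‖⁻¹ : ℝ) : ℂ) • A (f ν) with he
  have hon : Orthonormal ℂ e := hF.orthonormal_eigen f hf0 hf
  have hterm : ∀ ν, (⟪A (f ν), A x⟫_ℂ / (‖A (f ν)‖ : ℂ) ^ 2) • A (f ν) = ⟪e ν, A x⟫_ℂ • e ν := by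
    intro ν
    simp only [he, inner_smul_left, Complex.conj_ofReal, smul_smul]
    congr 1
    push_cast
    rw [div_eq_mul_inv]
    ring
  simp_rw [hterm]
  have hsum : Summable fun ν => ⟪e ν, A x⟫_ℂ • e ν := by
    have := (hon.orthogonalFamily.summable_iff_norm_sq_summable fun ν => ⟪e ν, A x⟫_ℂ).2
      (hon.inner_products_summable (A x))
    simpa using this
  have hin : ∀ v, HasSum (fun ν => ⟪e ν, A x⟫_ℂ * ⟪v, e ν⟫_ℂ)
      ⟪v, ∑' ν, ⟪e ν, A x⟫_ℂ • e ν⟫_ℂ := by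
    intro v
    have := hsum.hasSum.mapL (innerSL ℂ v)
    simpa [inner_smul_right] using this
  have hz : ∀ ν, ⟪e ν, A x - ∑' ν, ⟪e ν, A x⟫_ℂ • e ν⟫_ℂ = 0 := by
    intro ν
    rw [inner_sub_right, sub_eq_zero]
    refine HasSum.unique ?_ (hin (e ν))
    convert hasSum_single ν ?_ using 1
    · rw [inner_self_eq_norm_sq_to_K, hon.1]; simp
    · intro μ hμ
      rw [hon.2 hμ.symm, mul_zero]
  -- The remainder is orthogonal to every eigenspace of the compact self-adjoint operator `-A J A*`,
  -- so it must be zero.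
  have hmem : A x - ∑' ν, ⟪e ν, A x⟫_ℂ • e ν ∈ (⨆ μ, Module.End.eigenspace
        ((-(A ∘L J ∘L adjoint A) : W →L[ℂ] W) : W →ₗ[ℂ] W) μ)ᗮ := by
    rw [← Submodule.iInf_orthogonal, Submodule.mem_iInf]
    intro μ v hv
    have hv' : -(A (J (adjoint A v))) = μ • v := Module.End.mem_eigenspace_iff.1 hv
    by_cases hμ : μ = 0
    · rw [hμ, zero_smul, neg_eq_zero] at hv'
      have hv2 := hF.eigenspace_zero hv'
      have hA0 : ∀ y, ⟪v, A y⟫_ℂ = 0 := fun y => by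
        rw [← adjoint_inner_left, hv2, inner_zero_left]
      rw [inner_sub_right, hA0, zero_sub, neg_eq_zero]
      refine (hin v).unique ?_
      convert hasSum_zero with ν
      rw [he, inner_smul_right, hA0, mul_zero, mul_zero]
    -- An eigenvector `v` with `μ ≠ 0` comes back from `H`: `g = J A* v` solves `g = μ⁻¹ T g` and `v
    -- = -μ⁻¹ A g`. Simplicity then makes `v` a multiple of some `A f_ν`.
    · set g := J (adjoint A v) with hg
      have hgT : g = μ⁻¹ • T g := by
        rw [hF.T_apply, neg_eq_iff_eq_neg.1 hv', map_neg, map_neg, neg_neg, map_smul, map_smul, ← hg,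
          inv_smul_smul₀ hμ]
      have hvg : v = -(μ⁻¹ • A g) := by
        rw [← smul_neg, hv', inv_smul_smul₀ hμ]
      by_cases hg0 : g = 0
      · rw [hvg, hg0, map_zero, smul_zero, neg_zero, inner_zero_left]
      obtain ⟨c, hc⟩ := hsimple ⟨μ⁻¹, g, hg0, hgT⟩ g hgT
      have h2 := hz ⟨μ⁻¹, g, hg0, hgT⟩
      have h3 := hF.A_eigen_ne_zero (hf0 ⟨μ⁻¹, g, hg0, hgT⟩) (hf ⟨μ⁻¹, g, hg0, hgT⟩)
      rw [he, inner_smul_left, mul_eq_zero] at h2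
      have h4 := h2.resolve_left (by simp [h3])
      rw [hvg, hc, map_smul, smul_smul, inner_neg_left, inner_smul_left, h4, mul_zero, neg_zero]
  have hcomp : IsCompactOperator (-(A ∘L J ∘L adjoint A) : W →L[ℂ] W) :=
    (hA.comp_clm (J ∘L adjoint A)).neg
  rw [ContinuousLinearMap.orthogonalComplement_iSup_eigenspaces_eq_bot hcomp hF.isSymmetric_AJA,
    Submodule.mem_bot, sub_eq_zero] at hmem
  rw [hmem]
  convert hsum.hasSum using 1
  exact funext fun ν => by rw [← hmem]

/-- The eigenfunction expansion of the resolvent. -/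
lemma hasSum_resolvent (hA : IsCompactOperator A)
    (hsimple : ∀ (ν : charValues T) (g : H), g = (ν : ℂ) • T g → ∃ c : ℂ, g = c • f ν) {lam : ℂ}
    (hlam : lam ∉ charValues T) (u : H) :
    HasSum (fun ν => (lam / (lam - ν) * (⟪J (f ν), u - lam • T u⟫_ℂ / ⟪J (f ν), f ν⟫_ℂ)) • f ν)
      (-(lam • T u)) := by
  have h1 := (hF.hasSum_eigen f hf0 hf hA hsimple u).mapL (lam • (J ∘L adjoint A))
  convert h1 using 1
  · funext ν
    have hν := char_ne_zero (hf0 ν) (hf ν)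
    have hsub : lam - ν ≠ 0 := fun h => hlam (by rw [sub_eq_zero.1 h]; exact ν.2)
    have hn : (‖A (f ν)‖ : ℂ) ≠ 0 := by simpa using hF.A_eigen_ne_zero (hf0 ν) (hf ν)
    have e1 : J (adjoint A (A (f ν))) = -((ν : ℂ)⁻¹ • f ν) := by
      conv_rhs => rw [hf ν, inv_smul_smul₀ hν, hF.T_apply, neg_neg]
    -- The factor `lam - ν` produced here cancels the denominator in the expansion.
    have e2 : ⟪J (f ν), u - lam • T u⟫_ℂ = (lam - ν) * ⟪A (f ν), A u⟫_ℂ := by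
      rw [inner_sub_right, inner_smul_right, hF.T_apply, inner_neg_right, hF.symm (f ν) (J _),
        hF.invol, adjoint_inner_right, hF.J_eigen (hf ν), inner_neg_left, inner_smul_left,
        hF.conj_char (hf0 ν) (hf ν), adjoint_inner_left]
      ring
    rw [e2, hF.inner_J_eigen (hf0 ν) (hf ν), map_smul, FunLike.coe_smul, Pi.smul_apply, comp_apply,
      e1, smul_neg, smul_neg, smul_smul, smul_smul, ← neg_smul]
    congr 1
    field_simp
  · rw [FunLike.coe_smul, Pi.smul_apply, comp_apply, hF.T_apply, smul_neg, neg_neg]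

/-- The summand is the `L²` norm of one term of the kernel series. With `e_ν = A f_ν / ‖A f_ν‖` it
equals `‖lam‖ (‖ν‖ / ‖lam - ν‖) ‖A* e_ν‖²`. The quotient is bounded uniformly in `ν` by the norm of
the inverse of `1 - lam T`, and the remaining squares are summable by the Hilbert–Schmidt bound for
`A*`. -/
lemma summable_kernel_norms (hJ : ∀ f, ‖J f‖ = ‖f‖) {ι : Type*} (b : HilbertBasis ι ℂ H)
    {C : ℝ} (hC : ∀ F : Finset ι, ∑ i ∈ F, ‖A (b i)‖ ^ 2 ≤ C) {lam : ℂ}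
    (hu : IsUnit (1 - lam • T)) :
    Summable fun ν : charValues T =>
      ‖lam / (lam - ν)‖ * (‖f ν‖ ^ 2 / ‖⟪J (f ν), f ν⟫_ℂ‖) := by
  have hs : Summable fun ν => ‖adjoint A (((‖A (f ν)‖⁻¹ : ℝ) : ℂ) • A (f ν))‖ ^ 2 :=
    summable_of_sum_le (fun ν => by positivity)
      fun G => sum_norm_sq_adjoint_le b A hC (hF.orthonormal_eigen f hf0 hf) G
  set Q := Ring.inverse (1 - lam • T)
  refine (hs.mul_left (‖lam‖ * ‖Q‖)).of_nonneg_of_le (fun ν => by positivity) fun ν => ?_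
  have hν := char_ne_zero (hf0 ν) (hf ν)
  have hn : 0 < ‖A (f ν)‖ := by simpa using hF.A_eigen_ne_zero (hf0 ν) (hf ν)
  have hν' : 0 < ‖(ν : ℂ)‖ := by simpa using hν
  -- On `f ν` the operator `1 - lam T` is multiplication by `1 - lam / ν`, so boundedness of its
  -- inverse keeps this number away from zero.
  have h1 : f ν = Q ((1 - lam / ν) • f ν) := by
    have e : (1 - lam / ν) • f ν = (1 - lam • T) (f ν) := by
      rw [sub_smul, one_smul, sub_apply, one_apply_eq_self, FunLike.coe_smul, Pi.smul_apply]
      congr 1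
      conv_lhs => rw [hf ν]
      rw [smul_smul, div_mul_cancel₀ _ hν]
    rw [e]
    exact (congrArg (fun B : H →L[ℂ] H => B (f ν)) (Ring.inverse_mul_cancel _ hu)).symm
  have h2 : 1 ≤ ‖Q‖ * ‖1 - lam / ν‖ := by
    have h3 : ‖f ν‖ ≤ ‖Q‖ * (‖1 - lam / ν‖ * ‖f ν‖) := by
      conv_lhs => rw [h1]
      rw [← norm_smul]
      exact Q.le_opNorm _
    have : 0 < ‖f ν‖ := norm_pos_iff.2 (hf0 ν)
    nlinarith
  have h3 : ‖1 - lam / (ν : ℂ)‖ = ‖lam - ν‖ / ‖(ν : ℂ)‖ := by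
    rw [← norm_div, ← norm_neg]
    congr 1
    field_simp
    ring
  have h5 : ‖(ν : ℂ)‖ ≤ ‖Q‖ * ‖lam - ν‖ := by
    rw [h3] at h2
    have := mul_le_mul_of_nonneg_right h2 hν'.le
    rw [one_mul] at this
    refine this.trans_eq ?_
    field_simp
  have h6 : 0 < ‖lam - ν‖ := by
    by_contra hc
    have : ‖lam - ν‖ = 0 := le_antisymm (not_lt.1 hc) (norm_nonneg _)
    rw [this, mul_zero] at h5
    linarith
  rw [hF.inner_J_eigen (hf0 ν) (hf ν), hF.norm_eigen hJ (hf ν), map_smul, norm_smul, norm_neg,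
    norm_mul, norm_pow, Complex.norm_real, Complex.norm_real, norm_norm, norm_inv, norm_norm,
    norm_div]
  have e : ‖lam‖ / ‖lam - ν‖ * ((‖(ν : ℂ)‖ * ‖adjoint A (A (f ν))‖) ^ 2 /
      (‖(ν : ℂ)‖ * ‖A (f ν)‖ ^ 2)) =
      ‖lam‖ * (‖(ν : ℂ)‖ / ‖lam - ν‖) * (‖A (f ν)‖⁻¹ * ‖adjoint A (A (f ν))‖) ^ 2 := by
    field_simp
  rw [e]
  gcongr
  rwa [div_le_iff₀ h6]

end Factorization

end Abstract

section

/-! ### The integral kernel of `D₀⁻¹` and `D₁⁻¹` -/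

/-- The common kernel of `D₁⁻¹` and `-(D₀⁻¹)*`. -/
def kern (x y : I) : ℂ :=
  if y < x then (1 / 2 : ℂ) * ((y : ℝ) + 1) else (1 / 2 : ℂ) * ((y : ℝ) - 1)

lemma measurable_kern : Measurable fun p : I × I => kern p.1 p.2 := by
  refine Measurable.ite (measurableSet_lt measurable_snd measurable_fst) ?_ ?_ <;> fun_prop

lemma norm_kern_le (x y : I) : ‖kern x y‖ ≤ 1 := by
  have h := norm_add_one_le y
  rw [kern]
  split_ifs <;> rw [norm_mul] <;> norm_num <;> linarith [h.1, h.2]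

lemma conj_kern (x y : I) : conj (kern x y) = kern x y := by
  rw [kern]
  have : conj (2 : ℂ) = 2 := Complex.conj_ofNat 2
  split_ifs <;> simp [Complex.conj_ofReal, this]

instance : NullSingletonClass (volume : Measure I) := by
  refine ⟨fun x => ?_⟩
  rw [← volume_image_subtype_coe measurableSet_Icc]
  simp

lemma volume_real_Iio (y : I) : (volume : Measure I).real (Iio y) = (y : ℝ) + 1 := by
  have : (Subtype.val '' Iio y : Set ℝ) = Ico (-1) (y : ℝ) := by
    ext t
    simp only [mem_image, mem_Iio, Subtype.exists, mem_Ico]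
    constructor
    · rintro ⟨a, ha, h, rfl⟩
      exact ⟨ha.1, h⟩
    · rintro ⟨h1, h2⟩
      exact ⟨t, ⟨h1, h2.le.trans y.2.2⟩, h2, rfl⟩
  rw [Measure.real, ← volume_image_subtype_coe measurableSet_Icc, this, Real.volume_Ico,
    ENNReal.toReal_ofReal]
  · ring
  · linarith [y.2.1]

lemma volume_real_Ioi (y : I) : (volume : Measure I).real (Ioi y) = 1 - (y : ℝ) := by
  have h := measureReal_add_measureReal_compl (μ := (volume : Measure I)) (measurableSet_Iio (a := y))
  rw [compl_Iio, ← measureReal_congr (Ioi_ae_eq_Ici (a := y)), volume_real_Iio] at h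
  have : (volume : Measure I).real univ = 2 := by
    rw [Measure.real, volume_univ_I]
    norm_num
  linarith

lemma D1inv_eq_integral {r : Measure I} {ψ : I → ℂ} (hψ : Integrable ψ r) (x : I) :
    D1inv r ψ x = ∫ y, kern x y * ψ y ∂r := by
  have hk : Integrable (fun y => kern x y * ψ y) r :=
    hψ.bdd_mul (c := 1) (measurable_kern.comp measurable_prodMk_left).aestronglyMeasurable
      (Eventually.of_forall fun y => norm_kern_le x y)
  -- The measure `r` may charge `x`; that atom belongs to the second integral, matching the strict
  -- inequality in `kern`.
  rw [← integral_add_compl (measurableSet_Iio (a := x)) hk, compl_Iio, D1inv,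
    ← integral_const_mul, ← integral_const_mul]
  congr 1
  · refine setIntegral_congr_fun measurableSet_Iio fun y hy => ?_
    simp only [kern, if_pos (mem_Iio.1 hy), mul_assoc]
  · refine setIntegral_congr_fun measurableSet_Ici fun y hy => ?_
    simp only [kern, if_neg (not_lt.2 (mem_Ici.1 hy)), mul_assoc]

lemma integrable_kern_mul {g : I → ℂ} (hg : Integrable g volume) (y : I) :
    Integrable (fun x => kern x y * g x) volume :=
  hg.bdd_mul (c := 1) (measurable_kern.comp measurable_prodMk_right).aestronglyMeasurable
    (Eventually.of_forall fun x => norm_kern_le x y)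

lemma D0inv_eq_integral {g : I → ℂ} (hg : Integrable g volume) (y : I) :
    D0inv g y = -∫ x, kern x y * g x := by
  rw [← integral_add_compl (measurableSet_Ioi (a := y)) (integrable_kern_mul hg y), compl_Ioi,
    ← setIntegral_congr_set (Iio_ae_eq_Iic (a := y))]
  have h1 : ∫ x in Ioi y, kern x y * g x = (1 / 2 : ℂ) * ((y : ℝ) + 1) * ∫ x in Ioi y, g x := by
    rw [← integral_const_mul]
    refine setIntegral_congr_fun measurableSet_Ioi fun x hx => ?_
    simp only [kern, if_pos (mem_Ioi.1 hx)]
  have h2 : ∫ x in Iio y, kern x y * g x = (1 / 2 : ℂ) * ((y : ℝ) - 1) * ∫ x in Iio y, g x := by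
    rw [← integral_const_mul]
    refine setIntegral_congr_fun measurableSet_Iio fun x hx => ?_
    simp only [kern, if_neg (not_lt.2 (le_of_lt (mem_Iio.1 hx)))]
  -- Subtracting the mean turns the weights `1/2` and `-1/2` of the two integrals into `(1 - y) / 2`
  -- and `-(1 + y) / 2`, the values of `-kern`.
  have h3 : mean g = (1 / 2 : ℂ) * ((∫ x in Iio y, g x) + ∫ x in Ioi y, g x) := by
    rw [mean, ← integral_add_compl (measurableSet_Iio (a := y)) hg, compl_Iio,
      setIntegral_congr_set (Ioi_ae_eq_Ici (a := y))]
  rw [h1, h2, D0inv, integral_sub hg.integrableOn (integrable_const _),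
    integral_sub hg.integrableOn (integrable_const _), setIntegral_const, setIntegral_const,
    volume_real_Iio, volume_real_Ioi, h3]
  simp only [Complex.real_smul]
  push_cast
  ring

lemma integrable_conj {X : Type*} [MeasurableSpace X] {μ : Measure X} {g : X → ℂ}
    (hg : Integrable g μ) : Integrable (fun x => conj (g x)) μ :=
  ⟨RCLike.continuous_conj.comp_aestronglyMeasurable hg.1,
    hg.2.congr' (Eventually.of_forall fun x => by simp)⟩

lemma D0inv_conj {g : I → ℂ} (hg : Integrable g volume) (y : I) :
    D0inv (fun x => conj (g x)) y = conj (D0inv g y) := by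
  rw [D0inv_eq_integral (integrable_conj hg), D0inv_eq_integral hg, map_neg, ← integral_conj]
  simp only [map_mul, conj_kern]

/-- Dominated convergence: `kern x` jumps only at `x`, and for fixed `y` the exceptional set `x = y`
is Lebesgue null. Continuity is what allows vanishing to be transferred between measures of equal
support. -/
lemma continuous_D0inv {g : I → ℂ} (hg : Integrable g volume) : Continuous (D0inv g) := by
  have : D0inv g = fun y => -∫ x, kern x y * g x := funext (D0inv_eq_integral hg)
  rw [this]
  refine Continuous.neg (continuous_iff_continuousAt.2 fun y => ?_)
  refine continuousAt_of_dominated (bound := fun x => ‖g x‖)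
    (Eventually.of_forall fun z => (integrable_kern_mul hg z).1)
    (Eventually.of_forall fun z => Eventually.of_forall fun x => ?_) hg.norm ?_
  · rw [norm_mul]
    exact mul_le_of_le_one_left (norm_nonneg _) (norm_kern_le x z)
  · have hne : ∀ᵐ x : I, x ≠ y := by
      simp [ae_iff]
    filter_upwards [hne] with x hx
    refine ContinuousAt.mul ?_ continuousAt_const
    rcases lt_or_gt_of_ne hx with h | h
    · refine ContinuousAt.congr (f := fun z : I => (1 / 2 : ℂ) * ((z : ℝ) - 1)) (by fun_prop) ?_
      filter_upwards [lt_mem_nhds h] with z hz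
      rw [kern, if_neg (not_lt.2 (le_of_lt hz))]
    · refine ContinuousAt.congr (f := fun z : I => (1 / 2 : ℂ) * ((z : ℝ) + 1)) (by fun_prop) ?_
      filter_upwards [gt_mem_nhds h] with z hz
      rw [kern, if_pos hz]

/-- `D₁⁻¹` and `D₀⁻¹` are anti-adjoint. -/
lemma integral_mul_D1inv {r : Measure I} [IsFiniteMeasure r] {ψ g : I → ℂ} (hψ : Integrable ψ r)
    (hg : Integrable g volume) :
    ∫ x, g x * D1inv r ψ x = -∫ y, D0inv g y * ψ y ∂r := by
  have hint : Integrable (fun p : I × I => g p.1 * (kern p.1 p.2 * ψ p.2))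
      ((volume : Measure I).prod r) := by
    have h := (hg.mul_prod hψ).bdd_mul (c := 1) (f := fun p : I × I => kern p.1 p.2)
      measurable_kern.aestronglyMeasurable (Eventually.of_forall fun p => norm_kern_le _ _)
    refine h.congr (Eventually.of_forall fun p => ?_)
    simp only
    ring
  calc ∫ x, g x * D1inv r ψ x = ∫ x, ∫ y, g x * (kern x y * ψ y) ∂r := by
        simp_rw [D1inv_eq_integral hψ, integral_const_mul]
    _ = ∫ y, ∫ x, g x * (kern x y * ψ y) ∂volume ∂r :=
        integral_integral_swap hint
    _ = -∫ y, D0inv g y * ψ y ∂r := by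
        rw [← integral_neg]
        refine integral_congr_ae (Eventually.of_forall fun y => ?_)
        simp only
        rw [D0inv_eq_integral hg, neg_mul, neg_neg, ← integral_mul_const]
        refine integral_congr_ae (Eventually.of_forall fun x => ?_)
        simp only
        ring

/-! ### The swap of the two components -/

/-- The involution `(f₁, f₂) ↦ (f₂, f₁)` of `L²(I; ℂ²)`. -/
def swap : H →L[ℂ] H :=
  ContinuousLinearMap.compLpL 2 volume
    ((LinearIsometryEquiv.piLpCongrLeft 2 ℂ ℂ (Equiv.subLeft (1 : Fin 2))) :
      EuclideanSpace ℂ (Fin 2) →L[ℂ] EuclideanSpace ℂ (Fin 2))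

lemma coeFn_swap (f : H) : ∀ᵐ x, ∀ i, swap f x i = f x (1 - i) := by
  filter_upwards [ContinuousLinearMap.coeFn_compLpL (p := 2) (μ := (volume : Measure I))
    ((LinearIsometryEquiv.piLpCongrLeft 2 ℂ ℂ (Equiv.subLeft (1 : Fin 2))) :
      EuclideanSpace ℂ (Fin 2) →L[ℂ] EuclideanSpace ℂ (Fin 2)) f] with x hx i
  rw [swap, hx]
  fin_cases i <;> rfl

lemma inner_eq_integral (f g : H) :
    ⟪f, g⟫_ℂ = ∫ x, (conj (f x 0) * g x 0 + conj (f x 1) * g x 1) := by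
  rw [L2.inner_def]
  refine integral_congr_ae (Eventually.of_forall fun x => ?_)
  simp only [PiLp.inner_apply, Fin.sum_univ_two, RCLike.inner_apply]
  ring

lemma swap_swap (f : H) : swap (swap f) = f := by
  refine Lp.ext ?_
  filter_upwards [coeFn_swap (swap f), coeFn_swap f] with x h1 h2
  ext i
  rw [h1, h2, sub_sub_cancel]

lemma inner_swap_left (f g : H) :
    ⟪swap f, g⟫_ℂ = ∫ x, (conj (f x 1) * g x 0 + conj (f x 0) * g x 1) := by
  rw [inner_eq_integral]
  refine integral_congr_ae ?_
  filter_upwards [coeFn_swap f] with x h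
  simp [h]

lemma swap_symm (f g : H) : ⟪swap f, g⟫_ℂ = ⟪f, swap g⟫_ℂ := by
  rw [inner_swap_left, inner_eq_integral]
  refine integral_congr_ae ?_
  filter_upwards [coeFn_swap g] with x h
  simp [h, add_comm]

lemma norm_swap (f : H) : ‖swap f‖ = ‖f‖ := by
  have h : ⟪swap f, swap f⟫_ℂ = ⟪f, f⟫_ℂ := by rw [swap_symm, swap_swap]
  rw [inner_self_eq_norm_sq_to_K, inner_self_eq_norm_sq_to_K] at h
  norm_cast at h
  exact (sq_eq_sq₀ (norm_nonneg _) (norm_nonneg _)).1 h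

lemma indef_eq_inner (f g : H) : indef f g = ⟪swap g, f⟫_ℂ := by
  rw [inner_swap_left, indef]
  refine integral_congr_ae (Eventually.of_forall fun x => ?_)
  simp only
  ring

/-! ### The factorization of `T` -/

lemma memLp_D0inv (r : Measure I) [IsFiniteMeasure r] (f : H) (i : Fin 2) :
    MemLp (D0inv fun y => f y i) 2 r :=
  MemLp.of_bound (measurable_D0inv (integrable_comp f i)).aestronglyMeasurable (4 * ‖f‖)
    (Eventually.of_forall fun x => norm_D0inv_le' f i x)

lemma D0inv_congr_comp {f g : H} {i j : Fin 2} (h : ∀ᵐ x, f x i = g x j) :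
    (D0inv fun y => f y i) = D0inv fun y => g y j := D0inv_congr h

/-- The map sending `f` to `D₀⁻¹ f_i`, as an element of `L²(r)`. -/
def D0L (r : Measure I) [IsFiniteMeasure r] (i : Fin 2) : H →L[ℂ] Lp ℂ 2 r :=
  LinearMap.mkContinuous
    { toFun := fun f => (memLp_D0inv r f i).toLp
      map_add' := by
        intro f g
        rw [← MemLp.toLp_add]
        refine MemLp.toLp_congr _ _ (Eventually.of_forall fun x => ?_)
        rw [D0inv_congr (h := fun y => f y i + g y i) ?_]
        · exact D0inv_add (integrable_comp f i) (integrable_comp g i) x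
        · filter_upwards [Lp.coeFn_add f g] with y hy
          rw [hy]; rfl
      map_smul' := by
        intro c f
        rw [RingHom.id_apply, ← MemLp.toLp_const_smul]
        refine MemLp.toLp_congr _ _ (Eventually.of_forall fun x => ?_)
        rw [D0inv_congr (h := fun y => c * f y i) ?_]
        · exact D0inv_smul c _ x
        · filter_upwards [Lp.coeFn_smul c f] with y hy
          rw [hy]; rfl }
    ((measureUnivNNReal r : ℝ) ^ (ENNReal.toReal 2)⁻¹ * 4)
    (by
      intro f
      have h := Lp.norm_le_of_ae_bound (f := (memLp_D0inv r f i).toLp) (C := 4 * ‖f‖)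
        (by positivity)
        (by
          filter_upwards [(memLp_D0inv r f i).coeFn_toLp] with x hx
          rw [hx]
          exact norm_D0inv_le' f i x)
      refine h.trans (le_of_eq ?_)
      ring)

lemma coeFn_D0L (r : Measure I) [IsFiniteMeasure r] (i : Fin 2) (f : H) :
    D0L r i f =ᵐ[r] D0inv fun y => f y i :=
  (memLp_D0inv r f i).coeFn_toLp

variable (m n : Measure I) [IsFiniteMeasure m] [IsFiniteMeasure n]

/-- `f ↦ (D₀⁻¹ f₁, D₀⁻¹ f₂)`, as a map into `L²(m) ⊕ L²(n)`. -/
def D0Pair : H →L[ℂ] WithLp 2 (Lp ℂ 2 m × Lp ℂ 2 n) :=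
  ((WithLp.prodContinuousLinearEquiv 2 ℂ (Lp ℂ 2 m) (Lp ℂ 2 n)).symm :
    (Lp ℂ 2 m × Lp ℂ 2 n) →L[ℂ] WithLp 2 (Lp ℂ 2 m × Lp ℂ 2 n)) ∘L ((D0L m 0).prod (D0L n 1))

lemma inner_D0L (r : Measure I) [IsFiniteMeasure r] (i : Fin 2) (f g : H) :
    ⟪D0L r i f, D0L r i g⟫_ℂ =
      ∫ y, conj (D0inv (fun x => f x i) y) * D0inv (fun x => g x i) y ∂r := by
  rw [L2.inner_def]
  refine integral_congr_ae ?_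
  filter_upwards [coeFn_D0L r i f, coeFn_D0L r i g] with y h1 h2
  rw [h1, h2, RCLike.inner_apply, mul_comm]

lemma inner_D0Pair (f g : H) :
    ⟪D0Pair m n f, D0Pair m n g⟫_ℂ = ⟪D0L m 0 f, D0L m 0 g⟫_ℂ + ⟪D0L n 1 f, D0L n 1 g⟫_ℂ := rfl

lemma integrable_conj_mul_D1inv {r : Measure I} [IsFiniteMeasure r] (f g : H) (i j : Fin 2) :
    Integrable (fun x => conj (g x i) * D1inv r (D0inv fun y => f y j) x) volume :=
  (integrable_conj (integrable_comp g i)).mul_bdd (c := 2 * r.real univ * (4 * ‖f‖))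
    (measurable_D1inv (integrable_D0inv r f j)).aestronglyMeasurable
    (Eventually.of_forall fun x => norm_D1inv_le (norm_D0inv_le' f j) x)

lemma integral_conj_mul_D1inv {r : Measure I} [IsFiniteMeasure r] (f g : H) (i : Fin 2) :
    ∫ x, conj (g x i) * D1inv r (D0inv fun y => f y i) x = -⟪D0L r i g, D0L r i f⟫_ℂ := by
  rw [integral_mul_D1inv (integrable_D0inv r f i) (integrable_conj (integrable_comp g i)), inner_D0L]
  simp_rw [D0inv_conj (integrable_comp g i)]

/-- The weak form of `J T = -A* A`; each component is an instance of the anti-adjointness of `D₁⁻¹`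
and `D₀⁻¹`. -/
lemma inner_swap_T (f g : H) : ⟪swap g, T m n f⟫_ℂ = -⟪D0Pair m n g, D0Pair m n f⟫_ℂ := by
  rw [inner_swap_left, inner_D0Pair, neg_add, ← integral_conj_mul_D1inv, ← integral_conj_mul_D1inv,
    ← integral_add (integrable_conj_mul_D1inv f g 0 0) (integrable_conj_mul_D1inv f g 1 1)]
  refine integral_congr_ae ?_
  filter_upwards [coeFn_T m n f] with x hx
  rw [hx, add_comm]
  rfl

variable {m n}

omit [IsFiniteMeasure m] [IsFiniteMeasure n] in
-- The zero set of a continuous function is closed, so if it has full `m`-measure it contains the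
-- common support, which has full `n`-measure.
lemma ae_eq_zero_of_support_eq (hsupp : m.support = n.support) {φ : I → ℂ} (hφ : Continuous φ)
    (h : φ =ᵐ[m] 0) : φ =ᵐ[n] 0 := by
  have h1 : m.support ⊆ {x | φ x = 0} :=
    Measure.support_subset_of_isClosed (isClosed_eq hφ continuous_const) h
  rw [hsupp] at h1
  exact Filter.mem_of_superset Measure.support_mem_ae h1

lemma D0L_eq_zero_iff {r : Measure I} [IsFiniteMeasure r] {i : Fin 2} {f : H} :
    D0L r i f = 0 ↔ (D0inv fun y => f y i) =ᵐ[r] 0 := by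
  rw [Lp.eq_zero_iff_ae_eq_zero]
  exact ⟨fun h => (coeFn_D0L r i f).symm.trans h, fun h => (coeFn_D0L r i f).trans h⟩

lemma D0Pair_eq_zero_iff {f : H} : D0Pair m n f = 0 ↔ D0L m 0 f = 0 ∧ D0L n 1 f = 0 := by
  rw [D0Pair, ContinuousLinearMap.comp_apply, ContinuousLinearEquiv.coe_coe,
    ContinuousLinearEquiv.map_eq_zero_iff, ContinuousLinearMap.prod_apply, Prod.mk_eq_zero]

lemma factorization (hsupp : m.support = n.support) :
    Factorization (T m n) swap (D0Pair m n) where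
  T_apply f := by
    rw [eq_neg_iff_add_eq_zero]
    have h : swap (T m n f) + adjoint (D0Pair m n) (D0Pair m n f) = 0 := by
      refine ext_inner_left ℂ fun g => ?_
      rw [inner_add_right, ← swap_symm, inner_swap_T, adjoint_inner_right, neg_add_cancel,
        inner_zero_right]
    have := congrArg swap h
    rwa [map_add, swap_swap, map_zero] at this
  invol := swap_swap
  symm := swap_symm
  -- Membership in `ker A` means that both primitives vanish almost everywhere for their own
  -- measures; by equality of supports the measures may be exchanged.
  ker f hf := by
    rw [D0Pair_eq_zero_iff, D0L_eq_zero_iff, D0L_eq_zero_iff] at hf ⊢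
    have h0 : (D0inv fun y => swap f y 0) = D0inv fun y => f y 1 :=
      D0inv_congr_comp ((coeFn_swap f).mono fun x h => by simpa using h 0)
    have h1 : (D0inv fun y => swap f y 1) = D0inv fun y => f y 0 :=
      D0inv_congr_comp ((coeFn_swap f).mono fun x h => by simpa using h 1)
    rw [h0, h1]
    exact ⟨ae_eq_zero_of_support_eq hsupp.symm (continuous_D0inv (integrable_comp f 1)) hf.2,
      ae_eq_zero_of_support_eq hsupp (continuous_D0inv (integrable_comp f 0)) hf.1⟩

/-! ### The Hilbert-Schmidt property -/

lemma memLp_kern (y : I) (i : Fin 2) :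
    MemLp (fun x => EuclideanSpace.single i (kern x y)) 2 (volume : Measure I) := by
  refine MemLp.of_bound (C := 1) ?_ (Eventually.of_forall fun x => ?_)
  · have : Measurable fun x => EuclideanSpace.single i (kern x y) := by
      refine (WithLp.measurable_toLp 2 _).comp (measurable_pi_iff.2 fun j => ?_)
      by_cases h : j = i
      · subst h
        simpa using! measurable_kern.comp (measurable_prodMk_right (y := y))
      · simp [h]
    exact this.aestronglyMeasurable
  · rw [PiLp.norm_single]
    exact norm_kern_le x y

lemma norm_toLp_kern_sq_le (y : I) (i : Fin 2) : ‖(memLp_kern y i).toLp‖ ^ 2 ≤ 2 := by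
  have h := Lp.norm_le_of_ae_bound (f := (memLp_kern y i).toLp) (C := 1) zero_le_one
    (by
      filter_upwards [(memLp_kern y i).coeFn_toLp] with x hx
      rw [hx, PiLp.norm_single]
      exact norm_kern_le x y)
  have h2 : (measureUnivNNReal (volume : Measure I) : ℝ) = 2 := by
    rw [measureUnivNNReal, volume_univ_I]
    rfl
  rw [h2, mul_one] at h
  calc ‖(memLp_kern y i).toLp‖ ^ 2 ≤ ((2 : ℝ) ^ (ENNReal.toReal 2)⁻¹) ^ 2 := by gcongr
    _ = 2 := by
      rw [← Real.rpow_natCast, ← Real.rpow_mul (by norm_num)]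
      norm_num

lemma D0inv_eq_inner (f : H) (i : Fin 2) (y : I) :
    D0inv (fun x => f x i) y = -⟪(memLp_kern y i).toLp, f⟫_ℂ := by
  rw [D0inv_eq_integral (integrable_comp f i), L2.inner_def]
  congr 1
  refine integral_congr_ae ?_
  filter_upwards [(memLp_kern y i).coeFn_toLp] with x hx
  rw [hx, EuclideanSpace.inner_single_left, conj_kern]

/-- Evaluation of `D₀⁻¹ f_i` at `y` is the inner product with a vector of squared norm at most `2`.
Bessel bounds the sum pointwise in `y`, and integration against `r` finishes. -/
lemma sum_norm_sq_D0L_le (r : Measure I) [IsFiniteMeasure r] (i : Fin 2) {ι : Type*} {b : ι → H}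
    (hb : Orthonormal ℂ b) (F : Finset ι) : ∑ k ∈ F, ‖D0L r i (b k)‖ ^ 2 ≤ 2 * r.real univ := by
  have h1 : ∀ f : H, ‖D0L r i f‖ ^ 2 = ∫ y, ‖D0inv (fun x => f x i) y‖ ^ 2 ∂r := by
    intro f
    have h := inner_self_eq_norm_sq_to_K (𝕜 := ℂ) (D0L r i f)
    rw [inner_D0L] at h
    have e : ∀ z : ℂ, conj z * z = ((‖z‖ ^ 2 : ℝ) : ℂ) := fun z => by
      rw [Complex.conj_mul']; push_cast; rfl
    simp_rw [e, integral_complex_ofReal] at h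
    rw [← RCLike.ofReal_pow] at h
    exact (Complex.ofReal_injective h).symm
  simp_rw [h1]
  rw [← integral_finsetSum]
  · calc _ ≤ ∫ _, (2 : ℝ) ∂r := by
          refine integral_mono_of_nonneg (Eventually.of_forall fun y => by positivity)
            (integrable_const _) (Eventually.of_forall fun y => ?_)
          simp only [D0inv_eq_inner, norm_neg]
          simp_rw [norm_inner_symm _ (b _)]
          exact (hb.sum_inner_products_le _).trans (norm_toLp_kern_sq_le y i)
      _ = 2 * r.real univ := by rw [integral_const, smul_eq_mul, mul_comm]
  · intro k _
    exact (memLp_D0inv r (b k) i).integrable_norm_pow (by norm_num)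

lemma sum_norm_sq_D0Pair_le {ι : Type*} {b : ι → H} (hb : Orthonormal ℂ b) (F : Finset ι) :
    ∑ k ∈ F, ‖D0Pair m n (b k)‖ ^ 2 ≤ 2 * m.real univ + 2 * n.real univ := by
  have : ∀ f : H, ‖D0Pair m n f‖ ^ 2 = ‖D0L m 0 f‖ ^ 2 + ‖D0L n 1 f‖ ^ 2 := fun f =>
    WithLp.prod_norm_sq_eq_of_L2 _
  simp_rw [this]
  rw [Finset.sum_add_distrib]
  exact add_le_add (sum_norm_sq_D0L_le m 0 hb F) (sum_norm_sq_D0L_le n 1 hb F)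

end

section

/-! ### Simplicity of the eigenvalues -/

lemma kern_eq (x y : I) :
    kern x y = ((((y : ℝ) - 1) / 2 + (Ioi y).indicator (fun _ => (1 : ℝ)) x : ℝ) : ℂ) := by
  rw [kern]
  by_cases h : y < x
  · rw [if_pos h, indicator_of_mem (mem_Ioi.2 h)]
    push_cast
    ring
  · rw [if_neg h, indicator_of_notMem (by simpa using h)]
    push_cast
    ring

/-- The Green function of the second derivative with Dirichlet boundary conditions. -/
lemma integral_kern_mul_kern (y z : I) :
    ∫ x, kern x y * kern x z =
      (((1 + (z : ℝ)) / 2 * (1 - (y : ℝ)) - max ((z : ℝ) - y) 0 : ℝ) : ℂ) := by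
  have hv : (volume : Measure I).real univ = 2 := by
    rw [Measure.real, volume_univ_I]
    norm_num
  have hi : ∀ w : I, Integrable (fun x => (Ioi w).indicator (fun _ => (1 : ℝ)) x)
      (volume : Measure I) := fun w => (integrable_const 1).indicator measurableSet_Ioi
  have hI : ∀ w : I, ∫ x, (Ioi w).indicator (fun _ => (1 : ℝ)) x = 1 - (w : ℝ) := fun w => by
    rw [integral_indicator_const _ measurableSet_Ioi, volume_real_Ioi, smul_eq_mul, mul_one]
  have e : ∀ x : I, kern x y * kern x z = ((((y : ℝ) - 1) / 2 * (((z : ℝ) - 1) / 2) +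
      ((y : ℝ) - 1) / 2 * (Ioi z).indicator (fun _ => (1 : ℝ)) x +
      ((z : ℝ) - 1) / 2 * (Ioi y).indicator (fun _ => (1 : ℝ)) x +
      (Ioi (max y z)).indicator (fun _ => (1 : ℝ)) x : ℝ) : ℂ) := by
    intro x
    rw [kern_eq, kern_eq, ← Complex.ofReal_mul]
    congr 1
    have h : (Ioi (max y z)).indicator (fun _ => (1 : ℝ)) x =
        (Ioi y).indicator (fun _ => (1 : ℝ)) x * (Ioi z).indicator (fun _ => (1 : ℝ)) x := by
      rw [← Ioi_inter_Ioi, ← inter_indicator_mul]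
      simp
    rw [h]
    ring
  simp_rw [e]
  rw [integral_complex_ofReal]
  congr 1
  have i1 : Integrable (fun x : I => ((y : ℝ) - 1) / 2 * (((z : ℝ) - 1) / 2) +
      ((y : ℝ) - 1) / 2 * (Ioi z).indicator (fun _ => (1 : ℝ)) x) volume :=
    (integrable_const _).add ((hi z).const_mul _)
  have i2 : Integrable (fun x : I => ((y : ℝ) - 1) / 2 * (((z : ℝ) - 1) / 2) +
      ((y : ℝ) - 1) / 2 * (Ioi z).indicator (fun _ => (1 : ℝ)) x +
      ((z : ℝ) - 1) / 2 * (Ioi y).indicator (fun _ => (1 : ℝ)) x) volume :=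
    i1.add ((hi y).const_mul _)
  rw [integral_add i2 (hi _), integral_add i1 ((hi y).const_mul _),
    integral_add (integrable_const _) ((hi z).const_mul _), integral_const, integral_const_mul,
    integral_const_mul, hI, hI, hI, hv, smul_eq_mul]
  rcases le_total y z with h | h
  · have h' : (y : ℝ) ≤ z := h
    rw [max_eq_right h, max_eq_left (sub_nonneg.2 h')]
    ring
  · have h' : (z : ℝ) ≤ y := h
    rw [max_eq_left h, max_eq_right (sub_nonpos.2 h')]
    ring

lemma integrable_kern (z : I) : Integrable (fun x => kern x z) (volume : Measure I) := by
  simpa using integrable_kern_mul (integrable_const (1 : ℂ)) z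

lemma D0inv_one (g : I → ℂ) (hg : Integrable g volume) : D0inv g ⟨1, by norm_num⟩ = 0 := by
  rw [D0inv_eq_integral hg]
  have : ∀ x : I, kern x ⟨1, by norm_num⟩ = 0 := fun x => by
    rw [kern, if_neg (show ¬(⟨1, by norm_num⟩ : I) < x from not_lt.2 x.2.2)]
    simp
  simp [this]

lemma integrable_mul_D0inv (r : Measure I) [IsFiniteMeasure r] (f : H) (j : Fin 2) {w : I → ℝ}
    (hw : Continuous w) : Integrable (fun y => (w y : ℂ) * D0inv (fun x => f x j) y) r := by
  obtain ⟨C, hC⟩ := isCompact_univ.exists_bound_of_continuousOn hw.continuousOn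
  refine (integrable_D0inv r f j).bdd_mul (c := C) (by fun_prop)
    (Eventually.of_forall fun y => ?_)
  rw [Complex.norm_real]
  exact hC y (mem_univ y)

/-- The initial slope of `D₀⁻¹ f_i`, where `f_i = lam D₁⁻¹ (D₀⁻¹ f_j r)`. -/
def slope (r : Measure I) (lam : ℂ) (f : H) (j : Fin 2) : ℂ :=
  -(lam / 2) * ∫ y : I, ((1 - (y : ℝ) : ℝ) : ℂ) * D0inv (fun x => f x j) y ∂r

/-- Minus the Green function is `max (z - y) 0 - (1 + z) (1 - y) / 2`. The second part is linear in
`z` and yields the slope term; the first leaves a Volterra integral with nonnegative kernel. -/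
lemma D0inv_eq_volterra {r : Measure I} [IsFiniteMeasure r] {lam : ℂ} {f : H} {i j : Fin 2}
    (h : ∀ᵐ x, f x i = lam * D1inv r (D0inv fun y => f y j) x) (z : I) :
    D0inv (fun x => f x i) z = ((1 + (z : ℝ) : ℝ) : ℂ) * slope r lam f j +
      lam * ∫ y : I, ((max ((z : ℝ) - y) 0 : ℝ) : ℂ) * D0inv (fun x => f x j) y ∂r := by
  have h1 : ∫ x, kern x z * f x i =
      lam * ∫ x, kern x z * D1inv r (D0inv fun y => f y j) x := by
    rw [← integral_const_mul]
    refine integral_congr_ae ?_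
    filter_upwards [h] with x hx
    rw [hx]
    ring
  have h2 : ∀ y : I, D0inv (fun x => kern x z) y * D0inv (fun x => f x j) y =
      ((max ((z : ℝ) - y) 0 : ℝ) : ℂ) * D0inv (fun x => f x j) y -
        (((1 + (z : ℝ)) / 2 : ℝ) : ℂ) * (((1 - (y : ℝ) : ℝ) : ℂ) * D0inv (fun x => f x j) y) := by
    intro y
    rw [D0inv_eq_integral (integrable_kern z), integral_kern_mul_kern]
    push_cast
    ring
  rw [D0inv_eq_integral (integrable_comp f i), h1,
    integral_mul_D1inv (integrable_D0inv r f j) (integrable_kern z)]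
  simp_rw [h2]
  rw [integral_sub (integrable_mul_D0inv r f j (by fun_prop))
    ((integrable_mul_D0inv r f j (by fun_prop)).const_mul _), integral_const_mul, slope]
  push_cast
  ring

/-- Solutions of a coupled system of Volterra inequalities with positive kernels are nonnegative. -/
lemma nonneg_of_volterra {m n : Measure I} [IsFiniteMeasure m] [IsFiniteMeasure n] {a B : ℝ}
    (ha : 0 ≤ a) {u v : I → ℝ} (hu : Continuous u) (hv : Continuous v)
    (hBu : ∀ z, |u z| ≤ B) (hBv : ∀ z, |v z| ≤ B)
    (h1 : ∀ z : I, a * ∫ y : I, max ((z : ℝ) - y) 0 * v y ∂n ≤ u z)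
    (h2 : ∀ z : I, a * ∫ y : I, max ((z : ℝ) - y) 0 * u y ∂m ≤ v z) (z : I) :
    0 ≤ u z ∧ 0 ≤ v z := by
  -- Lower bounds are measured against the weight `exp (b z)`. This `b` gives `a * r.real univ ≤ b /
  -- 2` for both measures, so each application of the Volterra operator halves the constant (`key`);
  -- the `+ 1` makes `b` positive.
  set b : ℝ := 2 * a * (m.real univ + n.real univ) + 1 with hb
  have hb0 : 0 < b := by positivity
  have key : ∀ (r : Measure I) [IsFiniteMeasure r] (w : I → ℝ) (N : ℝ), 0 ≤ N → Continuous w →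
      r.real univ ≤ m.real univ + n.real univ → (∀ y : I, -(N * Real.exp (b * y)) ≤ w y) →
      ∀ z : I, -(N / 2 * Real.exp (b * z)) ≤ a * ∫ y : I, max ((z : ℝ) - y) 0 * w y ∂r := by
    intro r _ w N hN hw hr hNw z
    have p : ∀ y : I, -(N * Real.exp (b * z) / b) ≤ max ((z : ℝ) - y) 0 * w y := by
      intro y
      set t := max ((z : ℝ) - y) 0 with ht
      have ht0 : 0 ≤ t := le_max_right _ _
      -- For `y ≤ z` this is `b t ≤ exp (b t)` with `t = z - y`.
      have hexp : t * Real.exp (b * y) ≤ Real.exp (b * z) / b := by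
        rcases le_total (y : ℝ) z with h | h
        · have : t = z - y := max_eq_left (sub_nonneg.2 h)
          rw [le_div_iff₀ hb0]
          have e : Real.exp (b * z) = Real.exp (b * t) * Real.exp (b * y) := by
            rw [← Real.exp_add, this]
            ring_nf
          rw [e]
          have := Real.add_one_le_exp (b * t)
          nlinarith [Real.exp_pos (b * y)]
        · have : t = 0 := max_eq_right (sub_nonpos.2 h)
          rw [this, zero_mul]
          positivity
      have h4 := mul_le_mul_of_nonneg_left (hNw y) ht0
      have h5 := mul_le_mul_of_nonneg_left hexp hN
      have h6 : N * (Real.exp (b * z) / b) = N * Real.exp (b * z) / b := by ring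
      nlinarith
    have hint : Integrable (fun y : I => max ((z : ℝ) - y) 0 * w y) r := by
      have hc : Continuous fun y : I => max ((z : ℝ) - y) 0 * w y := by fun_prop
      obtain ⟨C, hC⟩ := isCompact_univ.exists_bound_of_continuousOn hc.continuousOn
      exact Integrable.of_bound hc.aestronglyMeasurable C
        (Eventually.of_forall fun y => hC y (mem_univ y))
    have h3 := integral_mono (integrable_const _) hint p
    rw [integral_const, smul_eq_mul] at h3
    have h4 := mul_le_mul_of_nonneg_left h3 ha
    refine le_trans ?_ h4
    have h7 : a * r.real univ ≤ b / 2 := by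
      have := mul_le_mul_of_nonneg_left hr ha
      rw [hb]
      linarith
    have h8 : 0 ≤ N * Real.exp (b * z) / b := by positivity
    have h9 := mul_le_mul_of_nonneg_right h7 h8
    have h10 : b / 2 * (N * Real.exp (b * z) / b) = N / 2 * Real.exp (b * z) := by field_simp
    rw [h10] at h9
    linarith
  have hB : 0 ≤ B := (abs_nonneg _).trans (hBu z)
  -- Feeding the bounds for `u` and `v` into each other repeatedly drives the negative part to zero
  -- like `2⁻ᵏ`. The initial factor `exp b` compensates for the weight at `-1`.
  have step : ∀ k : ℕ, ∀ y : I, -(B * Real.exp b / 2 ^ k * Real.exp (b * y)) ≤ u y ∧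
      -(B * Real.exp b / 2 ^ k * Real.exp (b * y)) ≤ v y := by
    intro k
    induction k with
    | zero =>
      intro y
      have h : B ≤ B * Real.exp b / 2 ^ 0 * Real.exp (b * y) := by
        rw [pow_zero, div_one, mul_assoc, ← Real.exp_add]
        refine le_mul_of_one_le_right hB (Real.one_le_exp ?_)
        nlinarith [y.2.1]
      exact ⟨by linarith [neg_le_of_abs_le (hBu y)], by linarith [neg_le_of_abs_le (hBv y)]⟩
    | succ k ih =>
      intro y
      have e : B * Real.exp b / 2 ^ (k + 1) = B * Real.exp b / 2 ^ k / 2 := by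
        rw [pow_succ, div_div]
      rw [e]
      exact ⟨(key n v _ (by positivity) hv (by linarith [measureReal_nonneg (μ := m) (s := univ)])
          (fun y => (ih y).2) y).trans (h1 y),
        (key m u _ (by positivity) hu (by linarith [measureReal_nonneg (μ := n) (s := univ)])
          (fun y => (ih y).1) y).trans (h2 y)⟩
  have lim : Tendsto (fun k : ℕ => -(B * Real.exp b / 2 ^ k * Real.exp (b * z))) atTop (𝓝 0) := by
    have h := (tendsto_pow_atTop_nhds_zero_of_lt_one (r := (1 / 2 : ℝ)) (by norm_num)
      (by norm_num)).const_mul (-(B * Real.exp b * Real.exp (b * z)))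
    rw [mul_zero] at h
    refine h.congr fun k => ?_
    rw [one_div, inv_pow]
    ring
  exact ⟨le_of_tendsto' lim fun k => (step k z).1, le_of_tendsto' lim fun k => (step k z).2⟩

variable {m n : Measure I} [IsFiniteMeasure m] [IsFiniteMeasure n]

section

variable {lam : ℂ} {f : H} (h : f = lam • T m n f)
include h

lemma eigen_comp_zero : ∀ᵐ x, f x 0 = lam * D1inv n (D0inv fun y => f y 1) x := by
  have h' : f =ᵐ[volume] (lam • T m n f : H) := by rw [← h]
  filter_upwards [h', Lp.coeFn_smul lam (T m n f), coeFn_T m n f] with x h1 h2 h3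
  rw [h1, h2, Pi.smul_apply, h3]
  rfl

lemma eigen_comp_one : ∀ᵐ x, f x 1 = lam * D1inv m (D0inv fun y => f y 0) x := by
  have h' : f =ᵐ[volume] (lam • T m n f : H) := by rw [← h]
  filter_upwards [h', Lp.coeFn_smul lam (T m n f), coeFn_T m n f] with x h1 h2 h3
  rw [h1, h2, Pi.smul_apply, h3]
  rfl

end

lemma re_integral_mul {r : Measure I} {w : I → ℝ} {φ : I → ℂ}
    (hi : Integrable (fun y => (w y : ℂ) * φ y) r) (c : ℂ) :
    (c * ∫ y, (w y : ℂ) * φ y ∂r).re = ∫ y, w y * (c * φ y).re ∂r := by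
  rw [← integral_const_mul]
  have := integral_re (𝕜 := ℂ) (hi.const_mul c)
  refine Eq.trans this.symm (integral_congr_ae (Eventually.of_forall fun y => ?_))
  change (c * ((w y : ℂ) * φ y)).re = _
  rw [mul_left_comm, Complex.re_ofReal_mul]

/-- Positivity: `s` is the sign of the eigenvalue. -/
lemma eigen_nonneg {a s : ℝ} (ha : 0 ≤ a) (hs : s * s = 1) {f : H}
    (h : f = ((s * a : ℝ) : ℂ) • T m n f)
    (hsl : slope n ((s * a : ℝ) : ℂ) f 1 = s * slope m ((s * a : ℝ) : ℂ) f 0) {c : ℂ}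
    (hc : 0 ≤ (c * slope m ((s * a : ℝ) : ℂ) f 0).re) :
    (c * slope m ((s * a : ℝ) : ℂ) f 0).re = 0 ∧
    ∀ z, 0 ≤ s * (c * D0inv (fun x => f x 0) z).re ∧ 0 ≤ (c * D0inv (fun x => f x 1) z).re := by
  set φ := D0inv fun x => f x 0 with hφ
  set ψ := D0inv fun x => f x 1 with hψ
  set p := (c * slope m ((s * a : ℝ) : ℂ) f 0).re with hp
  have cφ : Continuous φ := continuous_D0inv (integrable_comp f 0)
  have cψ : Continuous ψ := continuous_D0inv (integrable_comp f 1)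
  -- With eigenvalue `s a` and `s² = 1`, the pair `s Re (c φ)`, `Re (c ψ)` satisfies a system with
  -- coefficient `a ≥ 0` and one common initial slope `p`.
  have e1 : ∀ z : I, s * (c * φ z).re = (1 + z) * p +
      a * ∫ y : I, max ((z : ℝ) - y) 0 * (c * ψ y).re ∂n := by
    intro z
    have hz := D0inv_eq_volterra (eigen_comp_zero h) z
    rw [← re_integral_mul (integrable_mul_D0inv n f 1 (by fun_prop)) c, ← hφ] at *
    rw [hz, hsl, mul_add, Complex.add_re]
    have e3 : c * (((1 + (z : ℝ) : ℝ) : ℂ) * (s * slope m ((s * a : ℝ) : ℂ) f 0)) =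
        (((1 + (z : ℝ)) * s : ℝ) : ℂ) * (c * slope m ((s * a : ℝ) : ℂ) f 0) := by
      push_cast
      ring
    rw [e3, Complex.re_ofReal_mul, mul_left_comm c, Complex.re_ofReal_mul, ← hp]
    linear_combination ((1 + (z : ℝ)) * p + a *
      (c * ∫ y : I, ((max ((z : ℝ) - y) 0 : ℝ) : ℂ) * ψ y ∂n).re) * hs
  have e2 : ∀ z : I, (c * ψ z).re = (1 + z) * p +
      a * ∫ y : I, max ((z : ℝ) - y) 0 * (s * (c * φ y).re) ∂m := by
    intro z
    have hz := D0inv_eq_volterra (eigen_comp_one h) z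
    have e4 : ∫ y : I, max ((z : ℝ) - y) 0 * (s * (c * φ y).re) ∂m =
        s * (c * ∫ y : I, ((max ((z : ℝ) - y) 0 : ℝ) : ℂ) * φ y ∂m).re := by
      rw [re_integral_mul (integrable_mul_D0inv m f 0 (by fun_prop)) c, ← integral_const_mul]
      refine integral_congr_ae (Eventually.of_forall fun y => ?_)
      simp only
      ring
    rw [e4, hψ, hz, mul_add, Complex.add_re, mul_left_comm c, Complex.re_ofReal_mul,
      mul_left_comm c, Complex.re_ofReal_mul, ← hp]
    ring
  have cu : Continuous fun z => s * (c * φ z).re := by fun_prop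
  have cv : Continuous fun z => (c * ψ z).re := by fun_prop
  obtain ⟨C, hC⟩ := (isCompact_univ (X := I)).exists_bound_of_continuousOn cu.continuousOn
  obtain ⟨D, hD⟩ := (isCompact_univ (X := I)).exists_bound_of_continuousOn cv.continuousOn
  have pos : ∀ z : I, 0 ≤ (1 + (z : ℝ)) * p := fun z =>
    mul_nonneg (by linarith [z.2.1]) hc
  have res := nonneg_of_volterra (m := m) (n := n) (B := max C D) ha cu cv
    (fun z => (hC z (mem_univ z)).trans (le_max_left _ _))
    (fun z => (hD z (mem_univ z)).trans (le_max_right _ _))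
    (fun z => by rw [e1 z]; linarith [pos z]) (fun z => by rw [e2 z]; linarith [pos z])
  refine ⟨?_, res⟩
  -- At the right endpoint `ψ` vanishes, while the equation writes its value as `2 p` plus a
  -- nonnegative integral; hence `p = 0`.
  have h1 := e2 ⟨1, by norm_num⟩
  rw [hψ, D0inv_one _ (integrable_comp f 1), mul_zero, Complex.zero_re] at h1
  have h2 : 0 ≤ a * ∫ y : I, max ((1 : ℝ) - y) 0 * (s * (c * φ y).re) ∂m :=
    mul_nonneg ha (integral_nonneg fun y => mul_nonneg (le_max_right _ _) (res y).1)
  simp only at h1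
  linarith

lemma D0inv_add_smul (f g : H) (c : ℂ) (i : Fin 2) (z : I) :
    D0inv (fun x => (f + c • g : H) x i) z =
      D0inv (fun x => f x i) z + c * D0inv (fun x => g x i) z := by
  rw [D0inv_congr (h := fun x => f x i + c * g x i), D0inv_add (integrable_comp f i)
    ((integrable_comp g i).const_mul c), D0inv_smul]
  filter_upwards [Lp.coeFn_add f (c • g), Lp.coeFn_smul c g] with x h1 h2
  rw [h1, Pi.add_apply, h2]
  rfl

lemma slope_add_smul (r : Measure I) [IsFiniteMeasure r] (lam : ℂ) (f g : H) (c : ℂ) (j : Fin 2) :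
    slope r lam (f + c • g) j = slope r lam f j + c * slope r lam g j := by
  have hw : Continuous fun y : I => 1 - (y : ℝ) := by fun_prop
  have e : ∀ y : I, ((1 - (y : ℝ) : ℝ) : ℂ) * D0inv (fun x => (f + c • g : H) x j) y =
      ((1 - (y : ℝ) : ℝ) : ℂ) * D0inv (fun x => f x j) y +
        c * (((1 - (y : ℝ) : ℝ) : ℂ) * D0inv (fun x => g x j) y) := fun y => by
    rw [D0inv_add_smul]
    ring
  rw [slope]
  simp_rw [e]
  rw [integral_add (integrable_mul_D0inv r f j hw) ((integrable_mul_D0inv r g j hw).const_mul c),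
    integral_const_mul, slope, slope]
  ring

/-- Rotating by the conjugate of the slope `q` forces `|q|² = 0`. Once `q = 0`, the sign conclusion
holds for every `c`, hence for both `c` and `-c`, so `φ` and `ψ` vanish. Then `A f = 0`, which is
impossible for an eigenfunction. -/
lemma eigen_eq_zero_of_slope (hsupp : m.support = n.support) {a s : ℝ} (ha : 0 ≤ a)
    (hs : s * s = 1) {f : H} (h : f = ((s * a : ℝ) : ℂ) • T m n f)
    (hsl : slope n ((s * a : ℝ) : ℂ) f 1 = s * slope m ((s * a : ℝ) : ℂ) f 0) : f = 0 := by
  by_contra hf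
  set q := slope m ((s * a : ℝ) : ℂ) f 0 with hq
  have h0 : q = 0 := by
    have hqq : (conj q * q).re = ‖q‖ ^ 2 := by
      rw [Complex.conj_mul', ← Complex.ofReal_pow, Complex.ofReal_re]
    have := (eigen_nonneg ha hs h hsl (c := conj q) (by rw [← hq, hqq]; positivity)).1
    rw [← hq, hqq] at this
    simpa using this
  have hc : ∀ c z, 0 ≤ s * (c * D0inv (fun x => f x 0) z).re ∧
      0 ≤ (c * D0inv (fun x => f x 1) z).re := fun c =>
    (eigen_nonneg ha hs h hsl (c := c) (by rw [← hq, h0]; simp)).2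
  have hs0 : s ≠ 0 := by
    rintro rfl
    simp at hs
  have hre : ∀ c z, (c * D0inv (fun x => f x 0) z).re = 0 ∧
      (c * D0inv (fun x => f x 1) z).re = 0 := by
    intro c z
    have h1 := hc c z
    have h2 := hc (-c) z
    simp only [neg_mul, Complex.neg_re] at h2
    exact ⟨(mul_eq_zero.1 (le_antisymm (by linarith [h2.1]) h1.1)).resolve_left hs0,
      le_antisymm (by linarith [h2.2]) h1.2⟩
  have hz : ∀ w : ℂ, (∀ c : ℂ, (c * w).re = 0) → w = 0 := by
    intro w hw
    have h1 := hw 1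
    have h2 := hw Complex.I
    refine Complex.ext (by simpa using h1) (by simpa using h2)
  refine (factorization hsupp).A_eigen_ne_zero hf h ?_
  rw [D0Pair_eq_zero_iff, D0L_eq_zero_iff, D0L_eq_zero_iff]
  exact ⟨Eventually.of_forall fun z => hz _ fun c => (hre c z).1,
    Eventually.of_forall fun z => hz _ fun c => (hre c z).2⟩

/-- The slope mismatch `L` is a linear functional on the eigenspace with trivial kernel, so the
eigenspace has dimension at most one. -/
lemma eigenspace_simple (hsupp : m.support = n.support) {lam : ℂ} {f g : H} (hf0 : f ≠ 0)
    (hf : f = lam • T m n f) (hg : g = lam • T m n g) : ∃ c : ℂ, g = c • f := by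
  obtain ⟨l, rfl⟩ : ∃ l : ℝ, (l : ℂ) = lam :=
    ⟨lam.re, Complex.conj_eq_iff_re.1 ((factorization hsupp).conj_char hf0 hf)⟩
  obtain ⟨s, a, hs, ha, rfl⟩ : ∃ s a : ℝ, s * s = 1 ∧ 0 ≤ a ∧ s * a = l := by
    rcases le_total 0 l with h | h
    · exact ⟨1, l, by norm_num, h, by ring⟩
    · exact ⟨-1, -l, by norm_num, by linarith, by ring⟩
  set L : H → ℂ := fun f => slope n ((s * a : ℝ) : ℂ) f 1 - s * slope m ((s * a : ℝ) : ℂ) f 0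
    with hL
  have hLf : L f ≠ 0 := fun h =>
    hf0 (eigen_eq_zero_of_slope hsupp ha hs hf (sub_eq_zero.1 h))
  refine ⟨L g / L f, ?_⟩
  rw [← sub_eq_zero, sub_eq_add_neg, ← neg_smul]
  refine eigen_eq_zero_of_slope hsupp ha hs (m := m) (n := n) ?_ (sub_eq_zero.1 ?_)
  · rw [map_add, map_smul, smul_add, ← hg, smul_comm, ← hf]
  · have e : L (g + (-(L g / L f)) • f) = L g + (-(L g / L f)) * L f := by
      simp only [hL, slope_add_smul]
      ring
    refine e.trans ?_
    field_simp
    ring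

end

/-! ### Matrix kernels -/

lemma memLp_tensor (u v : H) :
    MemLp (fun p : I × I => WithLp.toLp 2 fun ij : Fin 2 × Fin 2 => u p.1 ij.1 * conj (v p.2 ij.2)) 2
      ((volume : Measure I).prod (volume : Measure I)) := by
  refine MemLp.of_eval_piLp fun ij => ?_
  have h1 := (Lp.memLp u).eval_piLp ij.1
  have h2 := (Lp.memLp v).eval_piLp ij.2
  have hm : AEStronglyMeasurable (fun p : I × I => u p.1 ij.1 * conj (v p.2 ij.2))
      ((volume : Measure I).prod (volume : Measure I)) :=
    (h1.1.comp_fst).mul (RCLike.continuous_conj.comp_aestronglyMeasurable h2.1.comp_snd)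
  refine (memLp_two_iff_integrable_sq_norm hm).2 ?_
  have := ((memLp_two_iff_integrable_sq_norm h1.1).1 h1).mul_prod
    ((memLp_two_iff_integrable_sq_norm h2.1).1 h2)
  simpa [mul_pow] using this

/-- The matrix kernel `u(x) v(y)*`. -/
def tensor (u v : H) : H2 := (memLp_tensor u v).toLp

lemma coeFn_tensor (u v : H) : ∀ᵐ p ∂((volume : Measure I).prod (volume : Measure I)),
    ∀ ij, tensor u v p ij = u p.1 ij.1 * conj (v p.2 ij.2) := by
  filter_upwards [(memLp_tensor u v).coeFn_toLp] with p hp ij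
  rw [tensor, hp]

lemma inner_tensor_tensor (h g u v : H) : ⟪tensor h g, tensor u v⟫_ℂ = ⟪h, u⟫_ℂ * ⟪v, g⟫_ℂ := by
  rw [inner_eq_integral, inner_eq_integral, ← integral_prod_mul, L2.inner_def]
  refine integral_congr_ae ?_
  filter_upwards [coeFn_tensor h g, coeFn_tensor u v] with p h1 h2
  simp only [PiLp.inner_apply, RCLike.inner_apply, h1, h2, Fintype.sum_prod_type, Fin.sum_univ_two,
    map_mul, Complex.conj_conj]
  ring

lemma norm_tensor (u v : H) : ‖tensor u v‖ = ‖u‖ * ‖v‖ := by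
  have h := inner_tensor_tensor u v u v
  simp only [inner_self_eq_norm_sq_to_K] at h
  norm_cast at h
  rw [← mul_pow] at h
  exact (sq_eq_sq₀ (norm_nonneg _) (by positivity)).1 h

lemma E_eq (f : H) : E f = (indef f f)⁻¹ • tensor f (swap f) := by
  refine Lp.ext ?_
  have hs := Measure.quasiMeasurePreserving_snd (μ := (volume : Measure I))
    (ν := (volume : Measure I)) |>.ae (coeFn_swap f)
  filter_upwards [(memLp_EFun f).coeFn_toLp, Lp.coeFn_smul (indef f f)⁻¹ (tensor f (swap f)),
    coeFn_tensor f (swap f), hs] with p h1 h2 h3 h4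
  ext ij
  rw [E, h1, h2, Pi.smul_apply, PiLp.smul_apply, h3, h4, smul_eq_mul]
  exact div_eq_inv_mul _ _

/-- Testing with `h = 1_s e_i` identifies the integrals of both sides over every measurable `s`,
which determines the `i`-th component almost everywhere. -/
lemma isKernelOf_of_inner {K : H2} {B : H →L[ℂ] H}
    (hKB : ∀ h g, ⟪h, B g⟫_ℂ = ⟪tensor h g, K⟫_ℂ) : IsKernelOf K B := by
  intro g i
  have hk : Integrable (fun p : I × I => ∑ j : Fin 2, K p (i, j) * g p.2 j)
      ((volume : Measure I).prod (volume : Measure I)) := by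
    refine integrable_finsetSum _ fun j _ => ?_
    have h1 := (Lp.memLp K).eval_piLp (i, j)
    have h2 : MemLp (fun p : I × I => g p.2 j) 2
        ((volume : Measure I).prod (volume : Measure I)) :=
      ((Lp.memLp g).eval_piLp j).comp_snd volume
    exact h1.integrable_mul h2
  refine Integrable.ae_eq_of_forall_setIntegral_eq _ _ (integrable_comp (B g) i)
    hk.integral_prod_left fun s hs _ => ?_
  set h : H := indicatorConstLp 2 hs (measure_ne_top volume s) (EuclideanSpace.single i (1 : ℂ))
    with hh
  have e1 : ⟪h, B g⟫_ℂ = ∫ x in s, B g x i := by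
    rw [hh, L2.inner_indicatorConstLp_eq_setIntegral_inner]
    refine integral_congr_ae (Eventually.of_forall fun x => ?_)
    simp only [EuclideanSpace.inner_single_left, map_one, one_mul]
  have hcoe : ∀ᵐ x : I, ∀ i', h x i' = s.indicator (fun _ => if i' = i then (1 : ℂ) else 0) x := by
    filter_upwards [indicatorConstLp_coeFn (p := 2) (hs := hs)
      (hμs := measure_ne_top (volume : Measure I) s) (c := EuclideanSpace.single i (1 : ℂ))]
      with x hx i'
    rw [hh, hx]
    by_cases hxs : x ∈ s
    · simp [hxs]
    · simp [hxs]
  have hc := Measure.quasiMeasurePreserving_fst (μ := (volume : Measure I))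
    (ν := (volume : Measure I)) |>.ae hcoe
  have e2 : ⟪tensor h g, K⟫_ℂ = ∫ p : I × I, s.indicator (fun _ => (1 : ℂ)) p.1 *
      ∑ j : Fin 2, K p (i, j) * g p.2 j ∂((volume : Measure I).prod (volume : Measure I)) := by
    rw [L2.inner_def]
    refine integral_congr_ae ?_
    filter_upwards [coeFn_tensor h g, hc] with p h1 h2
    simp only [PiLp.inner_apply, RCLike.inner_apply, h1, h2, Fintype.sum_prod_type, map_mul,
      Complex.conj_conj]
    by_cases hp : p.1 ∈ s
    · simp only [indicator_of_mem hp, one_mul]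
      rw [Finset.sum_eq_single i]
      · simp
      · intro b _ hb
        simp [hb]
      · simp
    · simp [indicator_of_notMem hp]
  rw [← e1, hKB, e2, integral_prod, ← integral_indicator hs]
  · refine integral_congr_ae (Eventually.of_forall fun x => ?_)
    simp only [integral_const_mul]
    by_cases hx : x ∈ s
    · simp [hx]
    · simp [hx]
  · refine (hk.indicator (hs.prod MeasurableSet.univ)).congr (Eventually.of_forall fun p => ?_)
    by_cases hp : p.1 ∈ s
    · simp [hp]
    · simp [hp]

/-! ### The eigenfunction expansion of the resolvent kernel. -/

section

variable {m n : Measure I} [IsFiniteMeasure m] [IsFiniteMeasure n]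

lemma isCompactOperator_D0Pair : IsCompactOperator (D0Pair m n) := by
  obtain ⟨_, b, _⟩ := exists_hilbertBasis ℂ H
  exact isCompactOperator_of_sum_norm_sq_le b _ fun F => sum_norm_sq_D0Pair_le b.orthonormal F

lemma isCompactOperator_T (hsupp : m.support = n.support) : IsCompactOperator (T m n) := by
  have h := (isCompactOperator_D0Pair (m := m) (n := n)).clm_comp
    (-(swap ∘L adjoint (D0Pair m n)))
  have e : ⇑(T m n) = ⇑(-(swap ∘L adjoint (D0Pair m n))) ∘ D0Pair m n :=
    funext fun f => (factorization hsupp).T_apply f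
  rwa [e]

section

variable (hsupp : m.support = n.support) (f : eigenvalues m n → H) (hf_ne : ∀ ν, f ν ≠ 0)
  (hf : ∀ ν, f ν = (ν : ℂ) • T m n (f ν)) {lam : ℂ} (hlam : lam ∉ eigenvalues m n)
include hsupp hf_ne hf hlam

/-- The eigenfunction expansion of the resolvent kernel converges absolutely in `L²`. -/
lemma summable_kernels : Summable fun ν : eigenvalues m n => (lam / (lam - (ν : ℂ))) • E (f ν) := by
  obtain ⟨_, b, _⟩ := exists_hilbertBasis ℂ H
  have hu := isUnit_one_sub_smul (isCompactOperator_T hsupp) hlam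
  refine Summable.of_norm (((factorization hsupp).summable_kernel_norms f hf_ne hf norm_swap b
    (fun F => sum_norm_sq_D0Pair_le b.orthonormal F) hu).congr fun ν => ?_)
  rw [E_eq, norm_smul, norm_smul, norm_tensor, norm_swap, norm_inv, indef_eq_inner, div_eq_inv_mul _
    ‖inner ℂ (swap (f ν)) (f ν)‖, sq]

/-- Pairing the kernel series with `tensor h g` gives, term by term, the pairing of `h` with the
expansion of `-lam T u`, where `u = (1 - lam T)⁻¹ g`. The two sums agree by uniqueness of limits. -/
lemma isKernelOf_tsum :
    IsKernelOf (∑' ν : eigenvalues m n, (lam / (lam - (ν : ℂ))) • E (f ν)) (R m n lam) := by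
  refine isKernelOf_of_inner fun h g => ?_
  have hu := isUnit_one_sub_smul (isCompactOperator_T hsupp) hlam
  set u := Ring.inverse (1 - lam • T m n) g
  have hg : u - lam • T m n u = g :=
    congrArg (fun B : H →L[ℂ] H => B g) (Ring.mul_inverse_cancel _ hu)
  have hR : R m n lam g = -(lam • T m n u) := rfl
  have h1 := ((factorization hsupp).hasSum_resolvent f hf_ne hf isCompactOperator_D0Pair
    (fun ν g hg => eigenspace_simple hsupp (hf_ne ν) (hf ν) hg) hlam u).mapL (innerSL ℂ h)
  have h2 := (summable_kernels hsupp f hf_ne hf hlam).hasSum.mapL (innerSL ℂ (tensor h g))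
  have e : (fun ν : eigenvalues m n => innerSL ℂ h ((lam / (lam - ν) *
      (⟪swap (f ν), u - lam • T m n u⟫_ℂ / ⟪swap (f ν), f ν⟫_ℂ)) • f ν)) =
      fun ν : eigenvalues m n =>
        innerSL ℂ (tensor h g) ((lam / (lam - (ν : ℂ))) • E (f ν)) := funext fun ν => by
    rw [innerSL_apply_apply, innerSL_apply_apply, hg, E_eq, indef_eq_inner, inner_smul_right,
      inner_smul_right, inner_smul_right, inner_tensor_tensor]
    ring
  rw [← e] at h2
  rw [hR]
  exact h1.unique h2

end

end

end Beam

end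

theorem mainTheorem8
    (m n : Measure Beam.I) [IsFiniteMeasure m] [IsFiniteMeasure n]
    (hm_left : m {⟨-1, by norm_num⟩} = 0) (hm_right : m {⟨1, by norm_num⟩} = 0)
    (hn_left : n {⟨-1, by norm_num⟩} = 0) (hn_right : n {⟨1, by norm_num⟩} = 0)
    (hsupp : m.support = n.support)
    (f : Beam.eigenvalues m n → Beam.H)
    (hf_ne : ∀ ν, f ν ≠ 0) (hf : ∀ ν, f ν = (ν : ℂ) • Beam.T m n (f ν))
    (lam : ℂ) (hlam : lam ∉ Beam.eigenvalues m n) :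
    IsCompactOperator (Beam.T m n) ∧
    IsUnit (1 - lam • Beam.T m n) ∧
    (∀ ν, Beam.indef (f ν) (f ν) ≠ 0) ∧
    ∃ K : Beam.H2,
      Tendsto
        (fun F : Finset (Beam.eigenvalues m n) =>
          toWeakSpace ℂ Beam.H2 (∑ ν ∈ F, (lam / (lam - (ν : ℂ))) • Beam.E (f ν)))
        atTop (𝓝 (toWeakSpace ℂ Beam.H2 K)) ∧
      Beam.IsKernelOf K (Beam.R m n lam) := by
  refine ⟨Beam.isCompactOperator_T hsupp,
    Beam.isUnit_one_sub_smul (Beam.isCompactOperator_T hsupp) hlam, fun ν => ?_,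
    ∑' ν : Beam.eigenvalues m n, (lam / (lam - (ν : ℂ))) • Beam.E (f ν), ?_,
    Beam.isKernelOf_tsum hsupp f hf_ne hf hlam⟩
  · rw [Beam.indef_eq_inner]
    exact (Beam.factorization hsupp).inner_J_eigen_ne_zero (hf_ne ν) (hf ν)
  -- The series converges in norm, and the passage to the weak topology is continuous.
  · exact ((toWeakSpaceCLM ℂ Beam.H2).continuous.tendsto _).comp
      (Beam.summable_kernels hsupp f hf_ne hf hlam).hasSum
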